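/- **Setting.** Consider a finite-horizon MDP with stages $h=1,\dots,H$ ($H\ge 1$), a measurable state space $\mathcal S$, a finite action set $\mathcal A\neq\emptyset$ and an initial distribution $\rho$. Playing $a$ in $s$ at stage $h$ yields a random reward with mean $r_h(s,a)$, bounded by $1$ in absolute value, and a next state $s'\sim\mathbb P_h(\cdot\mid s,a)$. A policy $\pi=(\pi_1,\dots,\pi_H)$ is a family of measurable maps $\pi_h:\mathcal S\to\mathcal A$; $V^\pi_h$ is its value function and $V^*_h=\sup_\pi V^\pi_h$. A controller draws, at the start of each episode, one of finitely many policies from a fixed distribution and plays it for the whole episode (a single policy is a special case). $\mathbb E_\pi$ denotes expectation over the trajectory $(S_1,A_1,\dots,S_H,A_H)$ of $\pi$ with $S_1\sim\rho$. Let $(\mathcal T_hQ)(s,a)=r_h(s,a)+\mathbb E_{s'\sim \mathbb P_h(s,a)}\max_{a'}Q_{h+1}(s',a')$. Let $\phi_h:\mathcal S\times\mathcal A\to\mathbb R^d$ ($d\ge1$) be measurable features with $\|\phi_h(s,a)\|_2\le1$, and let $\mathcal B$ be the Euclidean unit ball of $\mathbb R^d$. For a controller $\pi$ and a function $Q'=(Q'_1,\dots,Q'_{H+1})$,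 a *best on-policy fit* at stage $h$ is any minimizer $\theta^{\star}_h=\theta^{\star}_h(\pi,Q')$ of $\theta\mapsto\mathbb E_\pi\big(\langle\phi_h(S_h,A_h),\theta\rangle-(\mathcal T_hQ')(S_h,A_h)\big)^2$ over $\mathcal B$. **Misspecification.** Let $\mathcal C$ be a class of controllers (for instance all policies). The MDP and $\phi$ are $\varepsilon$-misspecified with respect to the low-rank condition (over $\mathcal C$) if for all $\pi\in\mathcal C$, all policies $\pi'$, and all measurable $Q'$ with $\|Q'_h\|_\infty\le1$ for every $h$ and $Q'_{H+1}=0$, there are best on-policy fits $\theta^\star_h$ along $\pi$ such that $$\Big|\sum_{h=1}^H\mathbb E_{\pi'}\big[\langle\phi_h(S_h,A_h),\theta^\star_h\rangle-(\mathcal T_hQ')(S_h,A_h)\big]\Big|\le\varepsilon .$$ **Algorithm (S³Q-learning)** with controller $\pi$, bonus $b$, and regularization $\lambda>0$. Initially $Q^{tar}_h=0$ for $h\in\{1,\dots,H+1\}$. In epoch $e=1,2,\dots$, for levels $\ell=H,H-1,\dots,1$: set $\widehat\theta_\ell=0$, $\Sigma_\ell=\lambda I$; play $2^e$ independent trajectories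 of $\pi$, and after each one update at every stage $h$ $$\widehat\theta_h\leftarrow\widehat\theta_h+\frac{\Sigma_h^{-1}\phi_h\,\mathrm{td}_h}{1+\|\phi_h\|^2_{\Sigma_h^{-1}}},\qquad \Sigma_h^{-1}\leftarrow\Sigma_h^{-1}-\frac{\Sigma_h^{-1}\phi_h\phi_h^\top\Sigma_h^{-1}}{1+\|\phi_h\|^2_{\Sigma_h^{-1}}},\qquad \mathrm{td}_h=r_h+\max_{a'}Q^{tar}_{h+1}(s_{h+1},a')-\langle\phi_h,\widehat\theta_h\rangle ,$$ where $\phi_h=\phi_h(s_h,a_h)$ and the right-hand sides use the old values; then set $\theta^{tar}_\ell=\arg\min_{\theta\in\mathcal B}\|\theta-\widehat\theta_\ell\|^2_{\Sigma_\ell}$ and $Q^{tar}_\ell=\min\{1,\langle\phi_\ell,\theta^{tar}_\ell\rangle+b_\ell\}$. After level $1$ set $\widehat Q=Q^{tar}$ and begin the next epoch. When stopped after $K$ trajectories, the algorithm returns the current $\widehat Q$; let $e_{tot}$ be the number of completed epochs, so that $e_{tot}\ge1$ exactly when $K\ge 2H$. Put $\widehat V_1(s)=\max_a\widehat Q_1(s,a)$.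 **Uncertainty function.** For $c>0$ and $\delta\in(0,1)$ let $n^*=\frac{K}{4H}$, $\delta^*=\frac{\delta}{2He_{tot}^2d}$, $$U_h(s,a)=c\Big\{\sqrt{d\log\tfrac{d\,n^*\,\mathrm e\,H}{\delta^*}}+\sqrt\lambda\Big\}\,\|\phi_h(s,a)\|_{\left(n^*\mathbb E_\pi[\phi_h\phi_h^\top]+\lambda I\right)^{-1}},\qquad \mathrm e=\exp(1).$$ **Theorem.** There is a universal constant $c>0$ such that the following holds for every MDP and feature map as above that are $\varepsilon$-misspecified with respect to the low-rank condition over $\mathcal C$, every controller $\pi\in\mathcal C$, every measurable bonus $b\ge0$, every $\lambda>0$ and every $\delta\in(0,1)$. With probability at least $1-\delta$, simultaneously for all $K\ge 2H$ (hence also at any data-dependent stopping time), the output $\widehat Q$ of S³Q-learning stopped after $K$ trajectories satisfies: (a) for all $h\in\{1,\dots,H\}$, every best on-policy fit $\theta^\star_h$ along $\pi$ with $Q'=\widehat Q$, and all $(s,a)$, the Bellman error $\mathrm{err}_h=\widehat Q_h-\mathcal T_h\widehat Q$ and the comparator error $\Delta_h=\mathcal T_h\widehat Q-\langle\phi_h,\theta^\star_h\rangle$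 satisfy $$\min\{0,-U_h+b_h\}(s,a)\le(\mathrm{err}_h+\Delta_h)(s,a)\le(U_h+b_h)(s,a);$$ (b) every greedy policy $\bar\pi$, $\bar\pi_h(s)\in\arg\max_a\widehat Q_h(s,a)$, satisfies $$\mathbb E_{S\sim\rho}(\widehat V_1-V^*_1)(S)\le\mathbb E_{S\sim\rho}(\widehat V_1-V^{\bar\pi}_1)(S)\le\mathbb E_{\bar\pi}\sum_{h=1}^H(U_h+b_h)(S_h,A_h)+\varepsilon,$$ where the expectation on the right may be $+\infty$. -/

import Mathlib

open MeasureTheory ProbabilityTheory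
open scoped ENNReal

noncomputable section

namespace S3Q

universe u v

/-! ## Finite-horizon Markov decision processes

Stages are numbered `0, …, H - 1` (stage `h` here is stage `h + 1` in one-based numbering).
Objects indexed by a stage are indexed by `ℕ`; the data at stages `≥ H` are never used. -/

/-- One step of a trajectory: `((s, a), (r, s'))`, i.e. state, action, reward, next state. -/
abbrev Step (S : Type u) (A : Type v) : Type (max u v) := (S × A) × (ℝ × S)

/-- A finite-horizon MDP.  `step h (s, a)` is the joint law of the random reward and of the next
state when `a` is played in `s` at stage `h`; its two marginals are the reward distribution and the
transition probability. -/
structure MDP (S : Type u) (A : Type v) [MeasurableSpace S] [MeasurableSpace A] where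
  H : ℕ
  H_pos : 0 < H
  ρ : Measure S
  isProbabilityMeasure_ρ : IsProbabilityMeasure ρ
  step : ℕ → Kernel (S × A) (ℝ × S)
  isMarkovKernel_step : ∀ h, IsMarkovKernel (step h)

attribute [instance] MDP.isProbabilityMeasure_ρ MDP.isMarkovKernel_step

/-- A policy: for every stage a (measurable) map from states to actions. -/
structure Policy (S : Type u) (A : Type v) [MeasurableSpace S] [MeasurableSpace A] where
  act : ℕ → S → A
  measurable_act : ∀ h, Measurable (act h)

/-- A stationary controller: at the start of each episode it draws one of finitely many policies
from a fixed distribution and plays it for the whole episode.  A single policy is the case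
`m = 1`. -/
structure Controller (S : Type u) (A : Type v) [MeasurableSpace S] [MeasurableSpace A] where
  m : ℕ
  weight : PMF (Fin m)
  policy : Fin m → Policy S A

/-- A family of state-action functions, one for each stage. -/
abbrev QFun (S : Type u) (A : Type v) : Type (max u v) := ℕ → S → A → ℝ

/-- `V_h(s) = max_a Q_h(s, a)`. -/
def maxQ {S : Type u} {A : Type v} (Q : QFun S A) (h : ℕ) (s : S) : ℝ := ⨆ a, Q h s a

/-- `π` is a greedy policy for `Q` on the stages `0, …, H - 1`. -/
def IsGreedy {S : Type u} {A : Type v} [MeasurableSpace S] [MeasurableSpace A]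
    (H : ℕ) (Q : QFun S A) (π : Policy S A) : Prop :=
  ∀ h < H, ∀ s a, Q h s a ≤ Q h s (π.act h s)

namespace MDP

variable {S : Type u} {A : Type v} [MeasurableSpace S] [MeasurableSpace A] (M : MDP S A)

/-- A trajectory `(s_h, a_h, r_h, s_{h+1})`, `0 ≤ h < H`. -/
abbrev Traj : Type (max u v) := Fin M.H → Step S A

/-- The law of the step made by `π` at stage `h`, given the current state. -/
def stepKernel (π : Policy S A) (h : ℕ) : Kernel S (Step S A) :=
  Kernel.deterministic (fun s => (s, π.act h s)) (measurable_id.prodMk (π.measurable_act h)) ⊗ₖ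
    Kernel.prodMkLeft S (M.step h)

/-- The law of the `n` steps made by `π` at the stages `h, …, h + n - 1`, given the state at
stage `h`. -/
def pathKernel (π : Policy S A) : (n h : ℕ) → Kernel S (Fin n → Step S A)
  | 0, _ => Kernel.const S (Measure.dirac Fin.elim0)
  | n + 1, h =>
    (M.stepKernel π h ⊗ₖ
        (pathKernel π n (h + 1)).comap (fun q : S × Step S A => q.2.2.2) (by fun_prop)).map
      (fun q => (Fin.cons q.1 q.2 : Fin (n + 1) → Step S A))

/-- The law of the trajectory of `π` started from `ρ`. -/
def law (π : Policy S A) : Measure M.Traj := M.ρ.bind (M.pathKernel π M.H 0)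

/-- The law of an episode of a controller. -/
def controllerLaw (π : Controller S A) : Measure M.Traj :=
  ∑ i, π.weight i • M.law (π.policy i)

/-- `E f(S_h, A_h)` when the trajectory has law `μ`. -/
def expect (μ : Measure M.Traj) (h : Fin M.H) (f : S → A → ℝ) : ℝ :=
  ∫ τ, f (τ h).1.1 (τ h).1.2 ∂μ

/-- The random rewards are almost surely bounded by one in absolute value. -/
def BoundedRewards : Prop := ∀ h < M.H, ∀ s a, ∀ᵐ q ∂M.step h (s, a), |q.1| ≤ 1

/-- The mean reward `r_h(s, a)`. -/
def meanReward (h : ℕ) (s : S) (a : A) : ℝ := ∫ q, q.1 ∂M.step h (s, a)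

/-- The value function `V^π_h(s)`. -/
def value (π : Policy S A) (h : ℕ) (s : S) : ℝ :=
  ∫ τ, ∑ j : Fin (M.H - h), M.meanReward (h + j) (τ j).1.1 (τ j).1.2
    ∂M.pathKernel π (M.H - h) h s

/-- The optimal value function `V^*_h(s) = sup_π V^π_h(s)`. -/
def optValue (h : ℕ) (s : S) : ℝ := ⨆ π : Policy S A, M.value π h s

/-- The Bellman optimality operator
`(T_h Q)(s, a) = r_h(s, a) + E_{s' ∼ P_h(s, a)} max_{a'} Q_{h+1}(s', a')`. -/
def bellman (Q : QFun S A) (h : ℕ) (s : S) (a : A) : ℝ :=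
  M.meanReward h s a + ∫ q, maxQ Q (h + 1) q.2 ∂M.step h (s, a)

/-- The class of all (measurable) state-action functions with `|Q_h| ≤ 1` at every stage that
vanish at the stage after the last one. -/
def QAll : Set (QFun S A) :=
  {Q | (∀ h a, Measurable fun s => Q h s a) ∧ (∀ h s a, |Q h s a| ≤ 1) ∧ Q M.H = 0}

end MDP

/-! ## Linear function approximation -/

/-- A feature map: measurable, with Euclidean norm at most one. -/
structure Features (S : Type u) (A : Type v) [MeasurableSpace S] (d : ℕ) where
  φ : ℕ → S → A → EuclideanSpace ℝ (Fin d)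
  measurable_φ : ∀ h a, Measurable fun s => φ h s a
  norm_φ_le : ∀ h s a, ‖φ h s a‖ ≤ 1

/-- The linear function `⟨φ_h(s, a), θ⟩`. -/
def Features.lin {S : Type u} {A : Type v} [MeasurableSpace S] {d : ℕ} (F : Features S A d)
    (θ : EuclideanSpace ℝ (Fin d)) (h : ℕ) (s : S) (a : A) : ℝ :=
  inner ℝ (F.φ h s a) θ

/-- The Euclidean unit ball of parameters. -/
abbrev unitBall (d : ℕ) : Set (EuclideanSpace ℝ (Fin d)) := Metric.closedBall 0 1

/-- The quadratic form `‖x‖²_G = xᵀ G x`. -/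
def quad {d : ℕ} (G : Matrix (Fin d) (Fin d) ℝ) (x : EuclideanSpace ℝ (Fin d)) : ℝ :=
  x.ofLp ⬝ᵥ G.mulVec x.ofLp

section Misspecification

variable {S : Type u} {A : Type v} [MeasurableSpace S] [MeasurableSpace A]
  (M : MDP S A) {d : ℕ} (F : Features S A d)

/-- `θ` is a best on-policy fit at stage `h` along the controller `π`, with `Q` as next-stage
function: it minimizes `E_π (⟨φ_h, θ⟩ - T_h Q)²` over the unit ball. -/
def IsBestPredictor (π : Controller S A) (Q : QFun S A) (h : Fin M.H)
    (θ : EuclideanSpace ℝ (Fin d)) : Prop :=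
  θ ∈ unitBall d ∧
    IsMinOn (fun w => M.expect (M.controllerLaw π) h
      fun s a => (F.lin w h s a - M.bellman Q h s a) ^ 2) (unitBall d) θ

/-- `ε`-misspecification with respect to the low-rank condition, for data-generating controllers
in the class `C`: for all `π ∈ C`, all policies `π'` and all `Q` in the class of all bounded
functions, a best on-policy fit along `π` has average Bellman error at most `ε` along `π'`.
The minimizer need not be unique, and only one suitable choice is asked for. -/
def LowRankMisspecified (C : Set (Controller S A)) (ε : ℝ) : Prop :=
  ∀ π ∈ C, ∀ π' : Policy S A, ∀ Q ∈ M.QAll,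
    ∃ θ : Fin M.H → EuclideanSpace ℝ (Fin d),
      (∀ h, IsBestPredictor M F π Q h (θ h)) ∧
      |∑ h : Fin M.H, M.expect (M.law π') h
        fun s a => F.lin (θ h) h s a - M.bellman Q h s a| ≤ ε

/-- The regularized expected cumulative covariance `n E_π[φ_h φ_hᵀ] + lam I`. -/
def expectedCov (π : Controller S A) (lam n : ℝ) (h : Fin M.H) : Matrix (Fin d) (Fin d) ℝ :=
  n • Matrix.of (fun i j => M.expect (M.controllerLaw π) h
    fun s a => (F.φ h s a).ofLp i * (F.φ h s a).ofLp j) + lam • 1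

/-- The uncertainty parameter `α(n, δ) = c (√(d log(d n e H / δ)) + √lam)`, `e = exp 1`. -/
def uncertaintyParam (c : ℝ) (d H : ℕ) (lam n δ : ℝ) : ℝ :=
  c * (√(d * Real.log (d * n * Real.exp 1 * H / δ)) + √lam)

/-- The uncertainty function `U_h(s, a)` after `K` trajectories and `etot` completed epochs. -/
def uncertainty (π : Controller S A) (c lam δ : ℝ) (K etot : ℕ) (h : Fin M.H) (s : S) (a : A) :
    ℝ :=
  let n : ℝ := K / (4 * M.H)
  let δ' : ℝ := δ / (2 * M.H * etot ^ 2 * d)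
  uncertaintyParam c d M.H lam n δ' * √(quad (expectedCov M F π lam n h)⁻¹ (F.φ h s a))

/-- The Bellman error `Q_h - T_h Q_{h+1}`. -/
def bellmanError (Q : QFun S A) (h : ℕ) (s : S) (a : A) : ℝ := Q h s a - M.bellman Q h s a

/-- The comparator error `T_h Q_{h+1} - ⟨φ_h, θ⟩` of a best on-policy fit `θ`. -/
def comparatorError (Q : QFun S A) (h : ℕ) (θ : EuclideanSpace ℝ (Fin d)) (s : S) (a : A) : ℝ :=
  M.bellman Q h s a - F.lin θ h s a

end Misspecification

/-! ## The algorithm -/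

/-- The memory of the algorithm: epoch counter, current level, number of trajectories used at the
current level, network parameters and inverse covariances of all stages, target network, and best
approximator (the target network at the end of the last completed epoch). -/
structure State (S : Type u) (A : Type v) (d : ℕ) where
  epoch : ℕ
  level : ℕ
  count : ℕ
  θ : ℕ → EuclideanSpace ℝ (Fin d)
  covInv : ℕ → Matrix (Fin d) (Fin d) ℝ
  Qtar : QFun S A
  Qbest : QFun S A

section Algorithm

variable {S : Type u} {A : Type v} [MeasurableSpace S] [MeasurableSpace A]
  (M : MDP S A) {d : ℕ} (F : Features S A d) (b : QFun S A) (lam : ℝ)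

/-- Second-order update of a network parameter with feature vector `x` and temporal difference
error `td`. -/
def paramUpdate (θ : EuclideanSpace ℝ (Fin d)) (P : Matrix (Fin d) (Fin d) ℝ)
    (x : EuclideanSpace ℝ (Fin d)) (td : ℝ) : EuclideanSpace ℝ (Fin d) :=
  θ + (td / (1 + quad P x)) • WithLp.toLp 2 (P.mulVec x.ofLp)

/-- Sherman–Morrison update of an inverse covariance with feature vector `x`. -/
def covUpdate (P : Matrix (Fin d) (Fin d) ℝ) (x : EuclideanSpace ℝ (Fin d)) :
    Matrix (Fin d) (Fin d) ℝ :=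
  P - (1 / (1 + quad P x)) • Matrix.vecMulVec (P.mulVec x.ofLp) (P.vecMul x.ofLp)

/-- The temporal difference error `r + max_{a'} Q_{h+1}(s', a') - ⟨φ_h(s, a), θ⟩`. -/
def tdError (Q : QFun S A) (θ : EuclideanSpace ℝ (Fin d)) (h : ℕ) (x : Step S A) : ℝ :=
  x.2.1 + maxQ Q (h + 1) x.2.2 - F.lin θ h x.1.1 x.1.2

/-- Processing one trajectory: networks and covariances of all stages are updated. -/
def playTrajectory (st : State S A d) (τ : M.Traj) : State S A d :=
  { st with
    count := st.count + 1
    θ := fun h => if hh : h < M.H then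
        paramUpdate (st.θ h) (st.covInv h) (F.φ h (τ ⟨h, hh⟩).1.1 (τ ⟨h, hh⟩).1.2)
          (tdError F st.Qtar (st.θ h) h (τ ⟨h, hh⟩))
      else st.θ h
    covInv := fun h => if hh : h < M.H then
        covUpdate (st.covInv h) (F.φ h (τ ⟨h, hh⟩).1.1 (τ ⟨h, hh⟩).1.2)
      else st.covInv h }

/-- The projection of `θ` onto the unit ball in the norm of the covariance `G` (the minimizer
exists, and is unique when `G` is positive definite). -/
def project (G : Matrix (Fin d) (Fin d) ℝ) (θ : EuclideanSpace ℝ (Fin d)) :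
    EuclideanSpace ℝ (Fin d) :=
  Classical.epsilon fun w => w ∈ unitBall d ∧ IsMinOn (fun w' => quad G (w' - θ)) (unitBall d) w

/-- Move to level `l`: its network and covariance are initialized. -/
def startLevel (st : State S A d) (l : ℕ) : State S A d :=
  { st with
    level := l
    count := 0
    θ := Function.update st.θ l 0
    covInv := Function.update st.covInv l (lam • (1 : Matrix (Fin d) (Fin d) ℝ))⁻¹ }

/-- Update of the target network at the current level: the parameter is projected, the bonus is
added, and the sum is clipped at one. -/
def updateTarget (st : State S A d) : State S A d :=
  let w := project (st.covInv st.level)⁻¹ (st.θ st.level)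
  { st with
    Qtar := Function.update st.Qtar st.level
      fun s a => min 1 (F.lin w st.level s a + b st.level s a) }

/-- One round of the algorithm: a trajectory is processed; when the current level has used
`2 ^ epoch` trajectories, its target network is updated and the next lower level begins, or, after
the lowest level, the target network is saved and a new epoch begins. -/
def round (st : State S A d) (τ : M.Traj) : State S A d :=
  let st₁ := playTrajectory M F st τ
  if st₁.count < 2 ^ st₁.epoch then st₁
  else
    let st₂ := updateTarget F b st₁
    if st₂.level = 0 then
      startLevel lam { st₂ with epoch := st₂.epoch + 1, Qbest := st₂.Qtar } (M.H - 1)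
    else startLevel lam st₂ (st₂.level - 1)

/-- The initial state: first epoch, top level, zero target network. -/
def initState : State S A d :=
  startLevel lam
    { epoch := 1, level := 0, count := 0, θ := 0, covInv := 0, Qtar := 0, Qbest := 0 } (M.H - 1)

/-- The state after the first `K` trajectories of the stream `x`. -/
def run (x : ℕ → M.Traj) : ℕ → State S A d
  | 0 => initState M lam
  | K + 1 => round M F b lam (run x K) (x K)

/-- The predictor returned by the algorithm when it is stopped after `K` trajectories. -/
def output (x : ℕ → M.Traj) (K : ℕ) : QFun S A := (run M F b lam x K).Qbest

/-- The number of epochs completed after `K` trajectories. -/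
def epochsCompleted (x : ℕ → M.Traj) (K : ℕ) : ℕ := (run M F b lam x K).epoch - 1

end Algorithm

end S3Q

end

/-!
The target fitted at level `ℓ` of epoch `e` minimizes a ridge loss over `2 ^ e` fresh trajectories,
whose labels `r + max_a Q_{ℓ+1}` depend on the trajectories seen so far only through the parameter
of `Q_{ℓ+1}` in the unit ball.  The Bernstein exponential moment of the excess loss, averaged over
the Lebesgue measure of the ball of all triples (label parameter, fitted parameter, comparator),
has mean at most one.  By Markov's inequality this average is small with high probability, and the
Lipschitz dependence on the triple turns the average into a bound for every triple at once.  The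
second moment of the excess loss of `u` over `v` is at most `36 E⟨φ, u - v⟩²`.  When `v` is a best
on-policy fit, it minimizes a convex quadratic over the ball, and its variational inequality bounds
`E⟨φ, u - v⟩²` by the mean excess loss; so the squared on-policy distance of the fitted target to
every best fit is `O(d log n / n)`, and Cauchy–Schwarz in the norm of the expected covariance bounds
the pointwise difference of the two linear functions by `U`.  Since `err + Δ = Q - ⟨φ, θ⋆⟩`, this
is the bound on the Bellman error, and summing it along a greedy policy with the
performance-difference identity leaves exactly the sum of `⟨φ, θ⋆⟩ - T Q` that the low-rank
condition controls.
-/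

noncomputable section

namespace S3Q

section UniformConcentration

variable {V X Ω : Type*} [MeasurableSpace X] [MeasurableSpace Ω]

/- Shrinking `K` towards `p` by the factor `L⁻¹` costs a factor `L ^ finrank ℝ V` in volume and
moves `f` by at most `diam K`, which turns the average bound into a pointwise one. -/
theorem le_of_setLIntegral_exp_le [NormedAddCommGroup V] [NormedSpace ℝ V]
    [FiniteDimensional ℝ V] [MeasurableSpace V] [BorelSpace V] {μ : Measure V}
    [μ.IsAddHaarMeasure] {K : Set V} (hKconv : Convex ℝ K) (hKcomp : IsCompact K)
    (hK0 : μ K ≠ 0) {f : V → ℝ} {L : NNReal} (hL : 1 ≤ L) (hf : LipschitzOnWith L f K)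
    {c : ℝ} (hc : 0 < c)
    (h : ∫⁻ q in K, ENNReal.ofReal (Real.exp (f q)) ∂μ ≤ ENNReal.ofReal c * μ K)
    {p : V} (hp : p ∈ K) :
    f p ≤ Metric.diam K + Module.finrank ℝ V * Real.log L + Real.log c := by
  have hL0 : (0 : ℝ) < L := by positivity
  have hr : (L : ℝ)⁻¹ ∈ Set.Icc (0 : ℝ) 1 :=
    ⟨by positivity, inv_le_one_of_one_le₀ (by exact_mod_cast hL)⟩
  set K' := AffineMap.homothety p (L : ℝ)⁻¹ '' K with hK'
  have hK'K : K' ⊆ K := by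
    rintro _ ⟨q, hq, rfl⟩
    rw [AffineMap.homothety_eq_lineMap]
    exact hKconv.lineMap_mem hp hq hr
  have hK'meas : MeasurableSet K' :=
    (hKcomp.image (AffineMap.homothety_continuous p _)).measurableSet
  have hfK' : ∀ q ∈ K', f p - Metric.diam K ≤ f q := by
    rintro _ ⟨q, hq, rfl⟩
    have hdist : dist p (AffineMap.homothety p (L : ℝ)⁻¹ q) = (L : ℝ)⁻¹ * dist p q := by
      rw [AffineMap.homothety_eq_lineMap, dist_left_lineMap, Real.norm_of_nonneg hr.1]
    have hlip := hf.dist_le_mul p hp _ (hK'K (Set.mem_image_of_mem _ hq))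
    rw [hdist, mul_inv_cancel_left₀ hL0.ne', Real.dist_eq] at hlip
    linarith [le_abs_self (f p - f (AffineMap.homothety p (L : ℝ)⁻¹ q)),
      Metric.dist_le_diam_of_mem hKcomp.isBounded hp hq]
  have havg : ENNReal.ofReal (Real.exp (f p - Metric.diam K)) * μ K' ≤ ENNReal.ofReal c * μ K :=
    calc ENNReal.ofReal (Real.exp (f p - Metric.diam K)) * μ K'
        = ∫⁻ _ in K', ENNReal.ofReal (Real.exp (f p - Metric.diam K)) ∂μ :=
          (setLIntegral_const _ _).symm
      _ ≤ ∫⁻ q in K', ENNReal.ofReal (Real.exp (f q)) ∂μ :=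
          setLIntegral_mono' hK'meas fun q hq => by gcongr; exact hfK' q hq
      _ ≤ ∫⁻ q in K, ENNReal.ofReal (Real.exp (f q)) ∂μ := lintegral_mono_set hK'K
      _ ≤ ENNReal.ofReal c * μ K := h
  rw [hK', Measure.addHaar_image_homothety, abs_of_pos (by positivity), ← mul_assoc,
    ENNReal.mul_le_mul_iff_left hK0 hKcomp.measure_lt_top.ne, ← ENNReal.ofReal_mul (by positivity),
    ENNReal.ofReal_le_ofReal_iff hc.le] at havg
  have hlog := Real.log_le_log (by positivity) havg
  rw [Real.log_mul (by positivity) (by positivity), Real.log_exp, Real.log_pow, Real.log_inv]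
    at hlog
  linarith

variable {P : Measure Ω} {ν : Measure X} {ι : Type*} [Fintype ι] {ξ : ι → Ω → X}

theorem lintegral_exp_sum_le_one {g : X → ℝ} (hg : Measurable g)
    (hexp : ∫⁻ x, ENNReal.ofReal (Real.exp (g x)) ∂ν ≤ 1) (hξ : ∀ i, Measurable (ξ i))
    (hind : iIndepFun ξ P) (hlaw : ∀ i, P.map (ξ i) = ν) :
    ∫⁻ ω, ENNReal.ofReal (Real.exp (∑ i, g (ξ i ω))) ∂P ≤ 1 := by
  have hgexp : Measurable fun x => ENNReal.ofReal (Real.exp (g x)) := by fun_prop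
  calc ∫⁻ ω, ENNReal.ofReal (Real.exp (∑ i, g (ξ i ω))) ∂P
      = ∫⁻ ω, ∏ i, ENNReal.ofReal (Real.exp (g (ξ i ω))) ∂P := by
        simp_rw [Real.exp_sum, ENNReal.ofReal_prod_of_nonneg fun _ _ => (Real.exp_pos _).le]
    _ = ∏ i, ∫⁻ ω, ENNReal.ofReal (Real.exp (g (ξ i ω))) ∂P :=
        lintegral_prod_eq_prod_lintegral_of_indepFun Finset.univ
          (fun i ω => ENNReal.ofReal (Real.exp (g (ξ i ω)))) (hind.comp _ fun _ => hgexp)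
          fun i => hgexp.comp (hξ i)
    _ ≤ 1 := Finset.prod_le_one' fun _ _ => by
        rwa [← lintegral_map hgexp (hξ _), hlaw]

theorem exists_event_lintegral_exp_sum_le [MeasurableSpace V] (μ : Measure V) [SFinite μ]
    [SFinite P] {K : Set V} (hKm : MeasurableSet K) (hK0 : μ K ≠ 0) (hKt : μ K ≠ ∞) {g : V → X → ℝ}
    (hg : Measurable (Function.uncurry g))
    (hexp : ∀ p ∈ K, ∫⁻ x, ENNReal.ofReal (Real.exp (g p x)) ∂ν ≤ 1)
    (hξ : ∀ i, Measurable (ξ i)) (hind : iIndepFun ξ P) (hlaw : ∀ i, P.map (ξ i) = ν)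
    {t : ℝ} (ht : 0 < t) :
    ∃ T : Set Ω, MeasurableSet T ∧ P Tᶜ ≤ ENNReal.ofReal t ∧ ∀ ω ∈ T,
      ∫⁻ p in K, ENNReal.ofReal (Real.exp (∑ i, g p (ξ i ω))) ∂μ ≤ ENNReal.ofReal t⁻¹ * μ K := by
  have hjoint : Measurable fun q : Ω × V => ENNReal.ofReal (Real.exp (∑ i, g q.2 (ξ i q.1))) :=
    ENNReal.measurable_ofReal.comp <| Real.measurable_exp.comp <| Finset.measurable_sum _ fun i _ =>
      hg.comp (measurable_snd.prodMk ((hξ i).comp measurable_fst))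
  set avg : Ω → ℝ≥0∞ := fun ω => ∫⁻ p in K, ENNReal.ofReal (Real.exp (∑ i, g p (ξ i ω))) ∂μ
  have havg : Measurable avg := hjoint.lintegral_prod_right'
  have hmean : ∫⁻ ω, avg ω ∂P ≤ μ K :=
    calc ∫⁻ ω, avg ω ∂P
        = ∫⁻ p in K, ∫⁻ ω, ENNReal.ofReal (Real.exp (∑ i, g p (ξ i ω))) ∂P ∂μ :=
          lintegral_lintegral_swap hjoint.aemeasurable
      _ ≤ ∫⁻ _ in K, 1 ∂μ := setLIntegral_mono' hKm fun p hp =>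
          lintegral_exp_sum_le_one (hg.comp measurable_prodMk_left) (hexp p hp) hξ hind hlaw
      _ = μ K := by simp
  have hbound0 : ENNReal.ofReal t⁻¹ * μ K ≠ 0 := mul_ne_zero (by simpa using ht) hK0
  have hboundt : ENNReal.ofReal t⁻¹ * μ K ≠ ∞ := ENNReal.mul_ne_top ENNReal.ofReal_ne_top hKt
  refine ⟨{ω | avg ω ≤ ENNReal.ofReal t⁻¹ * μ K}, measurableSet_le havg measurable_const, ?_,
    fun ω hω => hω⟩
  calc P {ω | avg ω ≤ ENNReal.ofReal t⁻¹ * μ K}ᶜ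
      ≤ P {ω | ENNReal.ofReal t⁻¹ * μ K ≤ avg ω} := measure_mono fun ω hω => by
        simp only [Set.mem_compl_iff, Set.mem_ofPred_eq, not_le] at hω ⊢
        exact hω.le
    _ ≤ (∫⁻ ω, avg ω ∂P) / (ENNReal.ofReal t⁻¹ * μ K) :=
        meas_ge_le_lintegral_div havg.aemeasurable hbound0 hboundt
    _ ≤ μ K / (ENNReal.ofReal t⁻¹ * μ K) := by gcongr
    _ = ENNReal.ofReal t := by
        rw [ENNReal.ofReal_inv_of_pos ht, ENNReal.div_eq_inv_mul,
          ENNReal.mul_inv (Or.inr hKt) (Or.inr hK0), inv_inv, mul_assoc,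
          ENNReal.inv_mul_cancel hK0 hKt, mul_one]

theorem integrable_of_forall_abs_le {μ : Measure X} [IsFiniteMeasure μ] {f : X → ℝ}
    (hf : Measurable f) {c : ℝ} (hc : ∀ x, |f x| ≤ c) : Integrable f μ :=
  .of_bound hf.aestronglyMeasurable c (ae_of_all _ hc)

theorem integrable_sq_of_forall_abs_le {μ : Measure X} [IsFiniteMeasure μ] {f : X → ℝ}
    (hf : Measurable f) {c : ℝ} (hc : ∀ x, |f x| ≤ c) : Integrable (fun x => f x ^ 2) μ :=
  integrable_of_forall_abs_le (hf.pow_const 2) (c := c ^ 2) fun x => by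
    rw [abs_pow]
    exact pow_le_pow_left₀ (abs_nonneg _) (hc x) 2

theorem lintegral_exp_sub_le_one [IsProbabilityMeasure ν] {D : X → ℝ} (hD : Measurable D)
    {B η : ℝ} (hB : ∀ x, |D x| ≤ B) (hη : 0 ≤ η) (hηB : η * B ≤ 1) :
    ∫⁻ x, ENNReal.ofReal (Real.exp (η * (∫ x, D x ∂ν) - η * D x - η ^ 2 * ∫ x, D x ^ 2 ∂ν)) ∂ν
      ≤ 1 := by
  have hint : Integrable D ν := integrable_of_forall_abs_le hD hB
  have hint_sq : Integrable (fun x => D x ^ 2) ν := integrable_sq_of_forall_abs_le hD hB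
  set m := ∫ x, D x ∂ν
  set s := ∫ x, D x ^ 2 ∂ν
  set Z : X → ℝ := fun x => Real.exp (η * m - η ^ 2 * s) * (1 - η * D x + η ^ 2 * D x ^ 2)
  have hexp_le : ∀ x, Real.exp (η * m - η * D x - η ^ 2 * s) ≤ Z x := fun x => by
    have hsmall : |-(η * D x)| ≤ 1 := by
      rw [abs_neg, abs_mul, abs_of_nonneg hη]
      exact (mul_le_mul_of_nonneg_left (hB x) hη).trans hηB
    have htaylor := (abs_le.1 (Real.abs_exp_sub_one_sub_id_le hsmall)).2
    rw [show η * m - η * D x - η ^ 2 * s = (η * m - η ^ 2 * s) + -(η * D x) by ring, Real.exp_add]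
    exact mul_le_mul_of_nonneg_left (by linarith) (Real.exp_pos _).le
  have hlin : Integrable (fun x => 1 - η * D x) ν := (integrable_const 1).sub (hint.const_mul η)
  have hZ : Integrable Z ν := (hlin.add (hint_sq.const_mul (η ^ 2))).const_mul _
  have hmean : ∫ x, Z x ∂ν = Real.exp (η * m - η ^ 2 * s) * (1 - (η * m - η ^ 2 * s)) := by
    rw [integral_const_mul, integral_add hlin (hint_sq.const_mul (η ^ 2)),
      integral_sub (integrable_const 1) (hint.const_mul η), integral_const_mul, integral_const_mul]
    simp only [integral_const, probReal_univ, smul_eq_mul, mul_one, m, s]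
    ring
  calc ∫⁻ x, ENNReal.ofReal (Real.exp (η * m - η * D x - η ^ 2 * s)) ∂ν
      ≤ ∫⁻ x, ENNReal.ofReal (Z x) ∂ν :=
        lintegral_mono fun x => ENNReal.ofReal_le_ofReal (hexp_le x)
    _ = ENNReal.ofReal (∫ x, Z x ∂ν) := (ofReal_integral_eq_lintegral_ofReal hZ
        (ae_of_all _ fun x => (Real.exp_pos _).le.trans (hexp_le x))).symm
    _ ≤ 1 := by
        rw [hmean, ENNReal.ofReal_le_one]
        calc _ ≤ Real.exp (η * m - η ^ 2 * s) * Real.exp (-(η * m - η ^ 2 * s)) := by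
              gcongr
              exact Real.one_sub_le_exp_neg _
          _ = 1 := by rw [← Real.exp_add, add_neg_cancel, Real.exp_zero]

theorem abs_integral_sub_integral_le [IsProbabilityMeasure ν] {f g : X → ℝ}
    (hf : Integrable f ν) (hg : Integrable g ν) {c : ℝ} (hc : ∀ x, |f x - g x| ≤ c) :
    |(∫ x, f x ∂ν) - ∫ x, g x ∂ν| ≤ c := by
  rw [← integral_sub hf hg]
  simpa using norm_integral_le_of_norm_le_const (f := fun x => f x - g x) (ae_of_all ν hc)

/-- The Bernstein-type exponent `η (E D - D) - η² E D²`, whose exponential has mean at most one when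
`η |D| ≤ 1`; the variance term is what makes fast rates possible. -/
def bernsteinExponent (ν : Measure X) (η : ℝ) (D : V → X → ℝ) (p : V) (x : X) : ℝ :=
  η * (∫ x, D p x ∂ν) - η * D p x - η ^ 2 * ∫ x, D p x ^ 2 ∂ν

theorem measurable_uncurry_bernsteinExponent [MeasurableSpace V] [SFinite ν] {D : V → X → ℝ}
    (hD : Measurable (Function.uncurry D)) (η : ℝ) :
    Measurable (Function.uncurry (bernsteinExponent ν η D)) := by
  have hmean : Measurable fun p => ∫ x, D p x ∂ν :=
    hD.stronglyMeasurable.integral_prod_right.measurable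
  have hvar : Measurable fun p => ∫ x, D p x ^ 2 ∂ν :=
    ((hD.pow_const 2).stronglyMeasurable.integral_prod_right
      (f := fun p x => D p x ^ 2)).measurable
  exact (((hmean.comp measurable_fst).const_mul η).sub (hD.const_mul η)).sub
    ((hvar.comp measurable_fst).const_mul (η ^ 2))

theorem abs_bernsteinExponent_sub_le [IsProbabilityMeasure ν] {D : V → X → ℝ} {p q : V}
    (hDp : Measurable (D p)) (hDq : Measurable (D q)) {B η r : ℝ} (hBp : ∀ x, |D p x| ≤ B)
    (hBq : ∀ x, |D q x| ≤ B) (hr : ∀ x, |D p x - D q x| ≤ r) (hη : 0 ≤ η) (hηB : η * B ≤ 1)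
    (x : X) :
    |bernsteinExponent ν η D p x - bernsteinExponent ν η D q x| ≤ 4 * η * r := by
  have hr0 : 0 ≤ r := (abs_nonneg _).trans (hr x)
  have hmean : |(∫ x, D p x ∂ν) - ∫ x, D q x ∂ν| ≤ r :=
    abs_integral_sub_integral_le (integrable_of_forall_abs_le hDp hBp)
      (integrable_of_forall_abs_le hDq hBq) hr
  have hvar : |(∫ x, D p x ^ 2 ∂ν) - ∫ x, D q x ^ 2 ∂ν| ≤ 2 * B * r :=
    abs_integral_sub_integral_le (integrable_sq_of_forall_abs_le hDp hBp)
      (integrable_sq_of_forall_abs_le hDq hBq) fun x => by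
        rw [sq_sub_sq, abs_mul]
        have hB := (abs_add_le (D p x) (D q x)).trans (add_le_add (hBp x) (hBq x))
        exact mul_le_mul (hB.trans (two_mul B).ge) (hr x) (abs_nonneg _)
          (by linarith [abs_nonneg (D p x), hBp x])
  have hηηB : η ^ 2 * (2 * B * r) ≤ 2 * η * r := by
    nlinarith [mul_le_mul_of_nonneg_left hηB (mul_nonneg hη hr0)]
  calc |bernsteinExponent ν η D p x - bernsteinExponent ν η D q x|
      = |η * ((∫ x, D p x ∂ν) - ∫ x, D q x ∂ν) - η * (D p x - D q x) -
          η ^ 2 * ((∫ x, D p x ^ 2 ∂ν) - ∫ x, D q x ^ 2 ∂ν)| := by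
        congr 1; simp only [bernsteinExponent]; ring
    _ ≤ η * r + η * r + η ^ 2 * (2 * B * r) := by
        refine (abs_sub _ _).trans (add_le_add ((abs_sub _ _).trans (add_le_add ?_ ?_)) ?_) <;>
          rw [abs_mul, abs_of_nonneg (by positivity)] <;> gcongr
        exact hr x
    _ ≤ 4 * η * r := by linarith

theorem exists_event_mean_sub_sq_le [NormedAddCommGroup V] [NormedSpace ℝ V]
    [FiniteDimensional ℝ V] [MeasurableSpace V] [BorelSpace V] [IsProbabilityMeasure P]
    [IsProbabilityMeasure ν] {K : Set V} (hKconv : Convex ℝ K) (hKcomp : IsCompact K)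
    (hKint : (interior K).Nonempty) {D : V → X → ℝ} (hD : Measurable (Function.uncurry D))
    {B L η : ℝ} (hB : ∀ p ∈ K, ∀ x, |D p x| ≤ B)
    (hL : ∀ p ∈ K, ∀ q ∈ K, ∀ x, |D p x - D q x| ≤ L * dist p q)
    (hη : 0 < η) (hηB : η * B ≤ 1) (hηL : 4 * η * L ≤ 1) [Nonempty ι]
    (hξ : ∀ i, Measurable (ξ i)) (hind : iIndepFun ξ P) (hlaw : ∀ i, P.map (ξ i) = ν)
    {t : ℝ} (ht : 0 < t) :
    ∃ T : Set Ω, MeasurableSet T ∧ P Tᶜ ≤ ENNReal.ofReal t ∧ ∀ ω ∈ T, ∀ p ∈ K,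
      Fintype.card ι * ((∫ x, D p x ∂ν) - η * ∫ x, D p x ^ 2 ∂ν) ≤ ∑ i, D p (ξ i ω) +
        η⁻¹ * (Metric.diam K + Module.finrank ℝ V * Real.log (Fintype.card ι) + Real.log t⁻¹) := by
  have hDp : ∀ p, Measurable (D p) := fun p => hD.of_uncurry_left
  have hK0 : (Measure.addHaar : Measure V) K ≠ 0 :=
    ((isOpen_interior.measure_pos _ hKint).trans_le (measure_mono interior_subset)).ne'
  obtain ⟨T, hTm, hTP, hT⟩ := exists_event_lintegral_exp_sum_le (Measure.addHaar : Measure V)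
    hKcomp.measurableSet hK0 hKcomp.measure_lt_top.ne
    (measurable_uncurry_bernsteinExponent hD η)
    (fun p hp => lintegral_exp_sub_le_one (hDp p) (hB p hp) hη.le hηB) hξ hind hlaw ht
  refine ⟨T, hTm, hTP, fun ω hω p hp => ?_⟩
  have hlip : LipschitzOnWith (Fintype.card ι)
      (fun p => ∑ i, bernsteinExponent ν η D p (ξ i ω)) K := by
    refine LipschitzOnWith.of_dist_le_mul fun p hp q hq => ?_
    rw [Real.dist_eq, ← Finset.sum_sub_distrib]
    calc _ ≤ ∑ i, |bernsteinExponent ν η D p (ξ i ω) - bernsteinExponent ν η D q (ξ i ω)| :=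
          Finset.abs_sum_le_sum_abs _ _
      _ ≤ ∑ _i : ι, dist p q := Finset.sum_le_sum fun i _ =>
          (abs_bernsteinExponent_sub_le (hDp p) (hDp q) (hB p hp) (hB q hq) (hL p hp q hq) hη.le
            hηB _).trans <| by
              rw [← mul_assoc]; exact mul_le_of_le_one_left dist_nonneg hηL
      _ = _ := by simp
  have hpoint := le_of_setLIntegral_exp_le hKconv hKcomp hK0
    (by exact_mod_cast Fintype.card_pos (α := ι)) hlip (inv_pos.2 ht) (hT ω hω) hp
  have hsum : ∑ i, bernsteinExponent ν η D p (ξ i ω) = η * (Fintype.card ι *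
      ((∫ x, D p x ∂ν) - η * ∫ x, D p x ^ 2 ∂ν) - ∑ i, D p (ξ i ω)) := by
    simp only [bernsteinExponent, Finset.sum_sub_distrib, Finset.sum_const, Finset.card_univ,
      nsmul_eq_mul, ← Finset.mul_sum]
    ring
  rw [hsum, ← le_inv_mul_iff₀ hη, NNReal.coe_natCast] at hpoint
  linarith

end UniformConcentration

section ExcessLoss

variable {W E X Ω : Type*} [NormedAddCommGroup E] [InnerProductSpace ℝ E] {φ : X → E}
  {Y : W → X → ℝ}

/-- The excess of the squared loss of the parameter `p.2.1` over that of `p.2.2` for the features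
`φ`, when the regression label is `Y p.1`.  The label parameter is part of the argument because the
deviation inequality is uniform in all three. -/
def excessLoss (φ : X → E) (Y : W → X → ℝ) (p : W × E × E) (x : X) : ℝ :=
  (inner ℝ (φ x) p.2.1 - Y p.1 x) ^ 2 - (inner ℝ (φ x) p.2.2 - Y p.1 x) ^ 2

theorem abs_inner_le_of_norm_le_one {u : E} (hu : ‖u‖ ≤ 1) (v : E) : |inner ℝ u v| ≤ ‖v‖ :=
  (abs_real_inner_le_norm u v).trans (mul_le_of_le_one_left (norm_nonneg v) hu)

theorem abs_excessLoss_le {p : W × E × E} {x : X} (hφ : ‖φ x‖ ≤ 1) (hY : |Y p.1 x| ≤ 2)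
    (hu : ‖p.2.1‖ ≤ 1) (hv : ‖p.2.2‖ ≤ 1) :
    |excessLoss φ Y p x| ≤ 6 * |inner ℝ (φ x) (p.2.1 - p.2.2)| := by
  have hinner_u := (abs_inner_le_of_norm_le_one hφ p.2.1).trans hu
  have hinner_v := (abs_inner_le_of_norm_le_one hφ p.2.2).trans hv
  have hfactor : excessLoss φ Y p x =
      (inner ℝ (φ x) p.2.1 + inner ℝ (φ x) p.2.2 - 2 * Y p.1 x) *
        inner ℝ (φ x) (p.2.1 - p.2.2) := by
    rw [inner_sub_right, excessLoss]; ring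
  rw [hfactor, abs_mul]
  gcongr
  rw [abs_le] at *
  constructor <;> linarith

theorem abs_excessLoss_le_twelve {p : W × E × E} {x : X} (hφ : ‖φ x‖ ≤ 1)
    (hY : |Y p.1 x| ≤ 2) (hu : ‖p.2.1‖ ≤ 1) (hv : ‖p.2.2‖ ≤ 1) : |excessLoss φ Y p x| ≤ 12 := by
  linarith [abs_excessLoss_le hφ hY hu hv, abs_inner_le_of_norm_le_one hφ (p.2.1 - p.2.2),
    norm_sub_le p.2.1 p.2.2]

theorem abs_sq_sub_sq_le {a b y z r : ℝ} (ha : |a| ≤ 1) (hb : |b| ≤ 1) (hy : |y| ≤ 2)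
    (hz : |z| ≤ 2) (hab : |a - b| ≤ r) (hyz : |y - z| ≤ r) :
    |(a - y) ^ 2 - (b - z) ^ 2| ≤ 12 * r := by
  have hsum : |(a - y) + (b - z)| ≤ 6 := by
    rw [abs_le] at *; constructor <;> linarith
  have hdiff : |(a - y) - (b - z)| ≤ 2 * r := by
    rw [abs_le] at *; constructor <;> linarith
  rw [sq_sub_sq, abs_mul]
  linarith [mul_le_mul hsum hdiff (abs_nonneg _) (by norm_num)]

theorem abs_excessLoss_sub_le [NormedAddCommGroup W] {p q : W × E × E} {x : X} (hφ : ‖φ x‖ ≤ 1)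
    (hYp : |Y p.1 x| ≤ 2) (hYq : |Y q.1 x| ≤ 2) (hlip : |Y p.1 x - Y q.1 x| ≤ ‖p.1 - q.1‖)
    (hp : ‖p‖ ≤ 1) (hq : ‖q‖ ≤ 1) : |excessLoss φ Y p x - excessLoss φ Y q x| ≤ 24 * dist p q := by
  have hinner : ∀ {v : E}, ‖v‖ ≤ 1 → |inner ℝ (φ x) v| ≤ 1 := fun hv =>
    (abs_inner_le_of_norm_le_one hφ _).trans hv
  have hinner_sub : ∀ {u v : E}, ‖u - v‖ ≤ ‖p - q‖ →
      |inner ℝ (φ x) u - inner ℝ (φ x) v| ≤ ‖p - q‖ := fun huv => by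
    rw [← inner_sub_right]
    exact (abs_inner_le_of_norm_le_one hφ _).trans huv
  have hlabel := hlip.trans (norm_fst_le (p - q))
  have hsnd := norm_snd_le (p - q)
  have hfirst := abs_sq_sub_sq_le (hinner ((norm_fst_le p.2).trans ((norm_snd_le p).trans hp)))
    (hinner ((norm_fst_le q.2).trans ((norm_snd_le q).trans hq))) hYp hYq
    (hinner_sub ((norm_fst_le (p - q).2).trans hsnd)) hlabel
  have hsecond := abs_sq_sub_sq_le (hinner ((norm_snd_le p.2).trans ((norm_snd_le p).trans hp)))
    (hinner ((norm_snd_le q.2).trans ((norm_snd_le q).trans hq))) hYp hYq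
    (hinner_sub ((norm_snd_le (p - q).2).trans hsnd)) hlabel
  rw [dist_eq_norm, show excessLoss φ Y p x - excessLoss φ Y q x =
    ((inner ℝ (φ x) p.2.1 - Y p.1 x) ^ 2 - (inner ℝ (φ x) q.2.1 - Y q.1 x) ^ 2) -
      ((inner ℝ (φ x) p.2.2 - Y p.1 x) ^ 2 - (inner ℝ (φ x) q.2.2 - Y q.1 x) ^ 2) by
      simp only [excessLoss]; ring]
  linarith [abs_sub _ _ |>.trans (add_le_add hfirst hsecond)]

variable [MeasurableSpace X] [MeasurableSpace E] [BorelSpace E] [FiniteDimensional ℝ E]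

theorem measurable_uncurry_excessLoss [MeasurableSpace W] (hφ : Measurable φ)
    (hY : Measurable (Function.uncurry Y)) : Measurable (Function.uncurry (excessLoss φ Y)) := by
  have hlabel : Measurable fun q : (W × E × E) × X => Y q.1.1 q.2 :=
    hY.comp (measurable_fst.fst.prodMk measurable_snd)
  have hfeature : Measurable fun q : (W × E × E) × X => φ q.2 := hφ.comp measurable_snd
  exact (((hfeature.inner measurable_fst.snd.fst).sub hlabel).pow_const 2).sub
    (((hfeature.inner measurable_fst.snd.snd).sub hlabel).pow_const 2)

theorem integral_excessLoss_sq_le {ν : Measure X} [IsFiniteMeasure ν] (hφm : Measurable φ)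
    (hφ : ∀ x, ‖φ x‖ ≤ 1) {p : W × E × E} (hY : ∀ x, |Y p.1 x| ≤ 2)
    (hu : ‖p.2.1‖ ≤ 1) (hv : ‖p.2.2‖ ≤ 1) :
    ∫ x, excessLoss φ Y p x ^ 2 ∂ν ≤ 36 * ∫ x, inner ℝ (φ x) (p.2.1 - p.2.2) ^ 2 ∂ν := by
  rw [← integral_const_mul]
  refine integral_mono_of_nonneg (ae_of_all _ fun x => sq_nonneg _)
    ((integrable_sq_of_forall_abs_le (hφm.inner measurable_const)
      fun x => abs_inner_le_of_norm_le_one (hφ x) _).const_mul _) (ae_of_all _ fun x => ?_)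
  calc excessLoss φ Y p x ^ 2 = |excessLoss φ Y p x| ^ 2 := (sq_abs _).symm
    _ ≤ (6 * |inner ℝ (φ x) (p.2.1 - p.2.2)|) ^ 2 :=
        pow_le_pow_left₀ (abs_nonneg _) (abs_excessLoss_le (hφ x) (hY x) hu hv) 2
    _ = 36 * inner ℝ (φ x) (p.2.1 - p.2.2) ^ 2 := by rw [mul_pow, sq_abs]; norm_num

/- The squared excess loss has mean at most `36 E⟨φ, u - v⟩²`, so with the scale `η = 1 / 96` the
variance term of the Bernstein exponent is absorbed by half of `E⟨φ, u - v⟩²`. -/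
theorem exists_event_excessLoss_le [NormedAddCommGroup W] [NormedSpace ℝ W]
    [FiniteDimensional ℝ W] [MeasurableSpace W] [BorelSpace W] [MeasurableSpace Ω]
    {P : Measure Ω} [IsProbabilityMeasure P] {ν : Measure X} [IsProbabilityMeasure ν]
    (hφm : Measurable φ) (hφ : ∀ x, ‖φ x‖ ≤ 1) (hYm : Measurable (Function.uncurry Y))
    (hY : ∀ w, ‖w‖ ≤ 1 → ∀ x, |Y w x| ≤ 2) (hlip : ∀ w w' x, |Y w x - Y w' x| ≤ ‖w - w'‖)
    {ι : Type*} [Fintype ι] [Nonempty ι] {ξ : ι → Ω → X} (hξ : ∀ i, Measurable (ξ i))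
    (hind : iIndepFun ξ P) (hlaw : ∀ i, P.map (ξ i) = ν) {t : ℝ} (ht : 0 < t) :
    ∃ T : Set Ω, MeasurableSet T ∧ P Tᶜ ≤ ENNReal.ofReal t ∧ ∀ ω ∈ T,
      ∀ w u v, ‖w‖ ≤ 1 → ‖u‖ ≤ 1 → ‖v‖ ≤ 1 →
        Fintype.card ι * (∫ x, excessLoss φ Y (w, u, v) x ∂ν -
            (∫ x, inner ℝ (φ x) (u - v) ^ 2 ∂ν) / 2) ≤
          ∑ i, excessLoss φ Y (w, u, v) (ξ i ω) + 96 * (2 + (Module.finrank ℝ W +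
            2 * Module.finrank ℝ E) * Real.log (Fintype.card ι) + Real.log t⁻¹) := by
  have hball : ∀ p ∈ Metric.closedBall (0 : W × E × E) 1,
      ‖p.1‖ ≤ 1 ∧ ‖p.2.1‖ ≤ 1 ∧ ‖p.2.2‖ ≤ 1 := fun p hp => by
    simpa only [mem_closedBall_zero_iff, Prod.norm_def, sup_le_iff] using hp
  obtain ⟨T, hTm, hTP, hT⟩ := exists_event_mean_sub_sq_le (η := 1 / 96) (B := 12) (L := 24)
    (convex_closedBall (0 : W × E × E) 1) (isCompact_closedBall 0 1)
    ⟨0, Metric.ball_subset_interior_closedBall (Metric.mem_ball_self one_pos)⟩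
    (measurable_uncurry_excessLoss hφm hYm)
    (fun p hp x => abs_excessLoss_le_twelve (hφ x) (hY _ (hball p hp).1 x) (hball p hp).2.1
      (hball p hp).2.2)
    (fun p hp q hq x => abs_excessLoss_sub_le (hφ x) (hY _ (hball p hp).1 x)
      (hY _ (hball q hq).1 x) (hlip _ _ x) (mem_closedBall_zero_iff.1 hp)
      (mem_closedBall_zero_iff.1 hq))
    (by norm_num) (by norm_num) (by norm_num) hξ hind hlaw ht
  refine ⟨T, hTm, hTP, fun ω hω w u v hw hu hv => ?_⟩
  have hdev := hT ω hω (w, u, v) (by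
    simpa only [mem_closedBall_zero_iff, Prod.norm_def, sup_le_iff] using ⟨hw, hu, hv⟩)
  have hdiam : Metric.diam (Metric.closedBall (0 : W × E × E) 1) ≤ 2 :=
    (Metric.diam_closedBall zero_le_one).trans_eq (mul_one 2)
  have hrank : (Module.finrank ℝ (W × E × E) : ℝ) =
      Module.finrank ℝ W + 2 * Module.finrank ℝ E := by
    simp only [Module.finrank_prod]; push_cast; ring
  have hvar := mul_le_mul_of_nonneg_left
    (integral_excessLoss_sq_le (ν := ν) (p := (w, u, v)) hφm hφ (hY w hw) hu hv)
    (Fintype.card ι).cast_nonneg (α := ℝ)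
  have hnonneg : 0 ≤ (Fintype.card ι : ℝ) * ∫ x, inner ℝ (φ x) (u - v) ^ 2 ∂ν :=
    mul_nonneg (Nat.cast_nonneg _) (integral_nonneg fun x => sq_nonneg _)
  rw [hrank] at hdev
  dsimp only at hvar
  linarith

end ExcessLoss

theorem abs_integral_le_of_ae_abs_le {X : Type*} [MeasurableSpace X] {μ : Measure X}
    [IsProbabilityMeasure μ] {f : X → ℝ} {c : ℝ} (hc : ∀ᵐ x ∂μ, |f x| ≤ c) :
    |∫ x, f x ∂μ| ≤ c := by
  simpa using norm_integral_le_of_norm_le_const (μ := μ) (f := f) hc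

section FiniteActions

variable {S A : Type*} [Finite A]

theorem le_maxQ (Q : QFun S A) (h : ℕ) (s : S) (a : A) : Q h s a ≤ maxQ Q h s :=
  le_ciSup (f := Q h s) (Set.finite_range _).bddAbove a

theorem measurable_maxQ [MeasurableSpace S] {Q : QFun S A} {h : ℕ}
    (hQ : ∀ a, Measurable fun s => Q h s a) : Measurable (maxQ Q h) :=
  Measurable.iSup hQ

variable [Nonempty A]

theorem abs_maxQ_le {Q : QFun S A} {h : ℕ} {s : S} {c : ℝ} (hQ : ∀ a, |Q h s a| ≤ c) :
    |maxQ Q h s| ≤ c := by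
  have a₀ := Classical.arbitrary A
  exact abs_le.2 ⟨(abs_le.1 (hQ a₀)).1.trans (le_maxQ Q h s a₀),
    ciSup_le fun a => (abs_le.1 (hQ a)).2⟩

theorem abs_maxQ_sub_maxQ_le {Q Q' : QFun S A} {h : ℕ} {s : S} {c : ℝ}
    (hQ : ∀ a, |Q h s a - Q' h s a| ≤ c) : |maxQ Q h s - maxQ Q' h s| ≤ c := by
  refine abs_sub_le_iff.2 ⟨sub_le_iff_le_add.2 <| ciSup_le fun a => ?_,
    sub_le_iff_le_add.2 <| ciSup_le fun a => ?_⟩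
  · linarith [(abs_le.1 (hQ a)).2, le_maxQ Q' h s a]
  · linarith [(abs_le.1 (hQ a)).1, le_maxQ Q h s a]

theorem maxQ_eq_of_forall_le {Q : QFun S A} {h : ℕ} {s : S} {a₀ : A}
    (hQ : ∀ a, Q h s a ≤ Q h s a₀) : maxQ Q h s = Q h s a₀ :=
  le_antisymm (ciSup_le hQ) (le_maxQ Q h s a₀)

variable [MeasurableSpace S] [MeasurableSpace A] [MeasurableSingletonClass A]

theorem exists_measurable_argmax {g : S → A → ℝ} (hg : ∀ a, Measurable fun s => g s a) :
    ∃ α : S → A, Measurable α ∧ ∀ s a, g s a ≤ g s (α s) := by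
  classical
  have := Fintype.ofFinite A
  suffices h : ∀ T : Finset A, T.Nonempty →
      ∃ α : S → A, Measurable α ∧ ∀ s, ∀ a ∈ T, g s a ≤ g s (α s) by
    simpa using h Finset.univ Finset.univ_nonempty
  intro T hT
  induction hT using Finset.Nonempty.cons_induction with
  | singleton a₀ => exact ⟨fun _ => a₀, measurable_const, by simp⟩
  | cons a₀ T _ _ ih =>
    obtain ⟨α, hα, hmax⟩ := ih
    have hgα : Measurable fun s => g s (α s) :=
      (measurable_from_prod_countable_left (f := fun x : S × A => g x.1 x.2) hg).comp
        (measurable_id.prodMk hα)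
    refine ⟨fun s => if g s a₀ ≤ g s (α s) then α s else a₀,
      Measurable.ite (measurableSet_le (hg a₀) hgα) hα measurable_const, fun s a ha => ?_⟩
    dsimp only
    split_ifs with hle
    · rcases Finset.mem_cons.1 ha with rfl | haT
      exacts [hle, hmax s a haT]
    · rcases Finset.mem_cons.1 ha with rfl | haT
      exacts [le_rfl, (hmax s a haT).trans (not_le.1 hle).le]

theorem exists_greedy_policy {Q : QFun S A} (hQ : ∀ h a, Measurable fun s => Q h s a) :
    ∃ π : Policy S A, ∀ h s a, Q h s a ≤ Q h s (π.act h s) := by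
  choose act hact hmax using fun h => exists_measurable_argmax (hQ h)
  exact ⟨⟨act, hact⟩, hmax⟩

end FiniteActions

namespace MDP

section Kernels

variable {S A : Type*}

theorem measurable_finCons {α : Type*} [MeasurableSpace α] {n : ℕ} :
    Measurable fun q : α × (Fin n → α) => (Fin.cons q.1 q.2 : Fin (n + 1) → α) :=
  measurable_pi_iff.2 <| Fin.cases measurable_fst fun j =>
    (measurable_pi_apply j).comp measurable_snd

variable [MeasurableSpace S] [MeasurableSpace A] (M : MDP S A)

instance isMarkovKernel_stepKernel (π : Policy S A) (h : ℕ) :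
    IsMarkovKernel (M.stepKernel π h) := by
  unfold stepKernel; infer_instance

instance isMarkovKernel_pathKernel (π : Policy S A) (n h : ℕ) :
    IsMarkovKernel (M.pathKernel π n h) := by
  induction n generalizing h with
  | zero => unfold pathKernel; infer_instance
  | succ n ih =>
    have := ih (h + 1)
    unfold pathKernel
    exact Kernel.IsMarkovKernel.map _ measurable_finCons

theorem lintegral_pathKernel_succ (π : Policy S A) (n h : ℕ) (s : S)
    {f : (Fin (n + 1) → Step S A) → ℝ≥0∞} (hf : Measurable f) :
    ∫⁻ τ, f τ ∂M.pathKernel π (n + 1) h s =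
      ∫⁻ q, ∫⁻ τ, f (Fin.cons ((s, π.act h s), q) τ) ∂M.pathKernel π n (h + 1) q.2
        ∂M.step h (s, π.act h s) := by
  have hfcons : Measurable fun q : Step S A × (Fin n → Step S A) => f (Fin.cons q.1 q.2) :=
    hf.comp measurable_finCons
  have htail : Measurable fun x : Step S A =>
      ∫⁻ τ, f (Fin.cons x τ) ∂M.pathKernel π n (h + 1) x.2.2 :=
    Measurable.lintegral_kernel_prod_right' (κ := (M.pathKernel π n (h + 1)).comap
      (fun x : Step S A => x.2.2) (by fun_prop)) hfcons
  rw [pathKernel, Kernel.map_apply _ measurable_finCons, lintegral_map hf measurable_finCons,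
    Kernel.lintegral_compProd _ _ _ hfcons]
  simp only [Kernel.comap_apply]
  rw [stepKernel, Kernel.lintegral_compProd _ _ _ htail]
  simp only [Kernel.prodMkLeft_apply]
  rw [Kernel.lintegral_deterministic' _
    (Measurable.lintegral_kernel_prod_right' (κ := M.step h) htail)]

theorem integral_pathKernel_succ (π : Policy S A) (n h : ℕ) (s : S)
    {f : (Fin (n + 1) → Step S A) → ℝ} (hf : Measurable f) {c : ℝ} (hc : ∀ τ, |f τ| ≤ c) :
    ∫ τ, f τ ∂M.pathKernel π (n + 1) h s =
      ∫ q, ∫ τ, f (Fin.cons ((s, π.act h s), q) τ) ∂M.pathKernel π n (h + 1) q.2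
        ∂M.step h (s, π.act h s) := by
  have hfcons : Measurable fun q : Step S A × (Fin n → Step S A) => f (Fin.cons q.1 q.2) :=
    hf.comp measurable_finCons
  have htail : Measurable fun x : Step S A =>
      ∫ τ, f (Fin.cons x τ) ∂M.pathKernel π n (h + 1) x.2.2 :=
    (StronglyMeasurable.integral_kernel_prod_right' (κ := (M.pathKernel π n (h + 1)).comap
      (fun x : Step S A => x.2.2) (by fun_prop)) hfcons.stronglyMeasurable).measurable
  have htail_le (x : Step S A) :
      |∫ τ, f (Fin.cons x τ) ∂M.pathKernel π n (h + 1) x.2.2| ≤ c :=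
    abs_integral_le_of_ae_abs_le (ae_of_all _ fun _ => hc _)
  rw [pathKernel, Kernel.map_apply _ measurable_finCons,
    integral_map measurable_finCons.aemeasurable hf.aestronglyMeasurable,
    integral_compProd (integrable_of_forall_abs_le hfcons fun q => hc _)]
  simp only [Kernel.comap_apply]
  rw [stepKernel, integral_compProd (integrable_of_forall_abs_le htail htail_le)]
  simp only [Kernel.prodMkLeft_apply]
  rw [Kernel.integral_deterministic' _
    (StronglyMeasurable.integral_kernel_prod_right' (κ := M.step h) htail.stronglyMeasurable)]

theorem lintegral_pathKernel_step (π : Policy S A) (n h : ℕ) (s : S) (j : Fin n)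
    {f : Step S A → ℝ≥0∞} (hf : Measurable f) :
    ∫⁻ τ, f (τ j) ∂M.pathKernel π n h s =
      ∫⁻ τ, ∫⁻ q, f ((τ j).1, q) ∂M.step (h + j) (τ j).1 ∂M.pathKernel π n h s := by
  induction n generalizing h s with
  | zero => exact j.elim0
  | succ n ih =>
    have heval : Measurable fun τ : Fin (n + 1) → Step S A => τ j := measurable_pi_apply j
    have hstep : Measurable fun τ : Fin (n + 1) → Step S A => f (τ j) := hf.comp heval
    have hcond : Measurable fun τ : Fin (n + 1) → Step S A =>
        ∫⁻ q, f ((τ j).1, q) ∂M.step (h + j) (τ j).1 :=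
      (Measurable.lintegral_kernel_prod_right' (κ := M.step (h + j)) hf).comp heval.fst
    rw [lintegral_pathKernel_succ M π n h s hstep, lintegral_pathKernel_succ M π n h s hcond]
    refine Fin.cases ?_ (fun i => ?_) j
    · simp
    · simp only [Fin.cons_succ]
      refine lintegral_congr fun q => ?_
      rw [ih (h + 1) q.2 i, Fin.val_succ, Nat.add_assoc, Nat.add_comm 1]

instance isProbabilityMeasure_law (π : Policy S A) : IsProbabilityMeasure (M.law π) := by
  unfold law; infer_instance

theorem lintegral_law (π : Policy S A) {f : M.Traj → ℝ≥0∞} (hf : Measurable f) :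
    ∫⁻ τ, f τ ∂M.law π = ∫⁻ s, ∫⁻ τ, f τ ∂M.pathKernel π M.H 0 s ∂M.ρ :=
  Measure.lintegral_bind (Kernel.aemeasurable _) hf.aemeasurable

theorem lintegral_law_step (π : Policy S A) (h : Fin M.H) {f : Step S A → ℝ≥0∞}
    (hf : Measurable f) :
    ∫⁻ τ, f (τ h) ∂M.law π = ∫⁻ τ, ∫⁻ q, f ((τ h).1, q) ∂M.step h (τ h).1 ∂M.law π := by
  have heval : Measurable fun τ : M.Traj => τ h := measurable_pi_apply h
  have hstep : Measurable fun τ : M.Traj => f (τ h) := hf.comp heval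
  have hcond : Measurable fun τ : M.Traj => ∫⁻ q, f ((τ h).1, q) ∂M.step h (τ h).1 :=
    (Measurable.lintegral_kernel_prod_right' (κ := M.step h) hf).comp heval.fst
  rw [lintegral_law M π hstep, lintegral_law M π hcond]
  refine lintegral_congr fun s => ?_
  simpa only [Nat.zero_add] using lintegral_pathKernel_step M π M.H 0 s h hf

theorem integral_law (π : Policy S A) {f : M.Traj → ℝ} (hf : Measurable f) {c : ℝ}
    (hc : ∀ τ, |f τ| ≤ c) :
    ∫ τ, f τ ∂M.law π = ∫ s, ∫ τ, f τ ∂M.pathKernel π M.H 0 s ∂M.ρ := by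
  have hlaw : M.law π = (M.pathKernel π M.H 0 ∘ₖ Kernel.const Unit M.ρ) () := by
    rw [Kernel.comp_apply, Kernel.const_apply, law]
  have hint : Integrable f (M.law π) := integrable_of_forall_abs_le hf hc
  rw [hlaw] at hint ⊢
  rw [Kernel.integral_comp hint, Kernel.const_apply]

instance isProbabilityMeasure_controllerLaw (π : Controller S A) :
    IsProbabilityMeasure (M.controllerLaw π) := by
  refine ⟨?_⟩
  simpa [controllerLaw, tsum_fintype] using π.weight.tsum_coe

theorem map_controllerLaw_step (π : Controller S A) (h : Fin M.H) :
    (M.controllerLaw π).map (fun τ => τ h) =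
      ((M.controllerLaw π).map fun τ => (τ h).1) ⊗ₘ M.step h := by
  have heval : Measurable fun τ : M.Traj => τ h := measurable_pi_apply h
  have : IsProbabilityMeasure ((M.controllerLaw π).map fun τ => (τ h).1) :=
    Measure.isProbabilityMeasure_map heval.fst.aemeasurable
  refine Measure.ext_of_lintegral _ fun f hf => ?_
  rw [lintegral_map hf heval, Measure.lintegral_compProd hf,
    lintegral_map (Measurable.lintegral_kernel_prod_right' hf) heval.fst]
  simp only [controllerLaw, lintegral_finsetSum_measure, lintegral_smul_measure]
  exact Finset.sum_congr rfl fun i _ => by rw [lintegral_law_step M _ h hf]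

end Kernels

end MDP

section BoundedMeasurable

variable {S A : Type*} [MeasurableSpace S]

/-- A state-action function is measurable in the state and bounded by `c` in absolute value: the
regularity that makes every expectation of the development a genuine integral. -/
structure BoundedMeasurable (f : S → A → ℝ) (c : ℝ) : Prop where
  measurable : ∀ a, Measurable fun s => f s a
  abs_le : ∀ s a, |f s a| ≤ c

namespace BoundedMeasurable

theorem sub {f g : S → A → ℝ} {c c' : ℝ} (hf : BoundedMeasurable f c)
    (hg : BoundedMeasurable g c') : BoundedMeasurable (fun s a => f s a - g s a) (c + c') where
  measurable a := (hf.measurable a).sub (hg.measurable a)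
  abs_le s a := (abs_sub _ _).trans (add_le_add (hf.abs_le s a) (hg.abs_le s a))

theorem measurable_uncurry [MeasurableSpace A] [Countable A] [MeasurableSingletonClass A]
    {f : S → A → ℝ} {c : ℝ} (hf : BoundedMeasurable f c) :
    Measurable fun x : S × A => f x.1 x.2 :=
  measurable_from_prod_countable_left hf.measurable

theorem integrable_maxQ [Finite A] [Nonempty A] {X : Type*} [MeasurableSpace X] {μ : Measure X}
    [IsFiniteMeasure μ] {Q : QFun S A} {h : ℕ} {c : ℝ} (hQ : BoundedMeasurable (Q h) c)
    {ξ : X → S} (hξ : Measurable ξ) : Integrable (fun x => maxQ Q h (ξ x)) μ :=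
  integrable_of_forall_abs_le ((measurable_maxQ hQ.measurable).comp hξ)
    fun x => abs_maxQ_le (hQ.abs_le (ξ x))

end BoundedMeasurable

end BoundedMeasurable

namespace MDP

section Bellman

variable {S A : Type*} [MeasurableSpace S] [MeasurableSpace A] {M : MDP S A}

variable (M) in
theorem measurable_integral_step {f : ℝ × S → ℝ} (hf : Measurable f) (h : ℕ) (a : A) :
    Measurable fun s => ∫ q, f q ∂M.step h (s, a) :=
  (StronglyMeasurable.integral_kernel_prod_right' (κ := M.step h)
    (hf.comp measurable_snd).stronglyMeasurable).measurable.comp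
      (measurable_id.prodMk measurable_const)

theorem BoundedRewards.boundedMeasurable_meanReward (hM : M.BoundedRewards) {h : ℕ}
    (hh : h < M.H) : BoundedMeasurable (M.meanReward h) 1 where
  measurable := M.measurable_integral_step measurable_fst h
  abs_le s a := abs_integral_le_of_ae_abs_le (hM h hh s a)

variable [Finite A] [Nonempty A]

theorem BoundedRewards.boundedMeasurable_bellman (hM : M.BoundedRewards) {Q : QFun S A} {h : ℕ}
    (hh : h < M.H) {c : ℝ} (hQ : BoundedMeasurable (Q (h + 1)) c) :
    BoundedMeasurable (M.bellman Q h) (1 + c) where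
  measurable a := ((hM.boundedMeasurable_meanReward hh).measurable a).add
    (M.measurable_integral_step ((measurable_maxQ hQ.measurable).comp measurable_snd) h a)
  abs_le s a := (abs_add_le _ _).trans <|
    add_le_add ((hM.boundedMeasurable_meanReward hh).abs_le s a) <|
      abs_integral_le_of_ae_abs_le (ae_of_all _ fun q => abs_maxQ_le (hQ.abs_le q.2))

theorem BoundedRewards.boundedMeasurable_bellmanError (hM : M.BoundedRewards) {Q : QFun S A}
    {c : ℝ} (hQ : ∀ h, BoundedMeasurable (Q h) c) {h : ℕ} (hh : h < M.H) :
    BoundedMeasurable (bellmanError M Q h) (c + (1 + c)) :=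
  (hQ h).sub (hM.boundedMeasurable_bellman hh (hQ (h + 1)))

end Bellman

section ExpectedReturn

variable {S A : Type*}

/-- The sum of `g` over the state-action pairs of a path that starts at stage `h`. -/
def pathReturn (g : QFun S A) {n : ℕ} (h : ℕ) (τ : Fin n → Step S A) : ℝ :=
  ∑ j : Fin n, g (h + j) (τ j).1.1 (τ j).1.2

theorem pathReturn_finCons (g : QFun S A) {n : ℕ} (h : ℕ) (x : Step S A) (τ : Fin n → Step S A) :
    pathReturn g h (Fin.cons x τ : Fin (n + 1) → Step S A) =
      g h x.1.1 x.1.2 + pathReturn g (h + 1) τ := by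
  simp only [pathReturn, Fin.sum_univ_succ, Fin.cons_zero, Fin.cons_succ, Fin.val_zero,
    Fin.val_succ, Nat.add_zero, Nat.add_assoc, Nat.add_comm 1]

variable [MeasurableSpace S] {g : QFun S A} {c : ℝ} {N n h : ℕ}

theorem abs_pathReturn_le (hg : ∀ k < N, BoundedMeasurable (g k) c) (hn : h + n ≤ N)
    (τ : Fin n → Step S A) : |pathReturn g h τ| ≤ n * c := by
  calc _ ≤ ∑ j : Fin n, |g (h + j) (τ j).1.1 (τ j).1.2| := Finset.abs_sum_le_sum_abs _ _
    _ ≤ ∑ _j : Fin n, c := Finset.sum_le_sum fun j _ => (hg _ (by omega)).abs_le _ _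
    _ = n * c := by simp

variable [MeasurableSpace A] (M : MDP S A)

/-- The value of `π` over the stages `h, …, h + n - 1` for the reward function `g`; it is the value
function when `g` is the mean reward and the expected sum of Bellman errors when `g` is the
Bellman error. -/
def expectedReturn (g : QFun S A) (π : Policy S A) (n h : ℕ) (s : S) : ℝ :=
  ∫ τ, pathReturn g h τ ∂M.pathKernel π n h s

theorem value_eq_expectedReturn (π : Policy S A) (h : ℕ) (s : S) :
    M.value π h s = M.expectedReturn M.meanReward π (M.H - h) h s := rfl

theorem abs_expectedReturn_le (hg : ∀ k < N, BoundedMeasurable (g k) c) (hn : h + n ≤ N)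
    (π : Policy S A) (s : S) : |M.expectedReturn g π n h s| ≤ n * c :=
  abs_integral_le_of_ae_abs_le (ae_of_all _ (abs_pathReturn_le hg hn))

variable [Countable A] [MeasurableSingletonClass A]

theorem measurable_pathReturn (hg : ∀ k < N, BoundedMeasurable (g k) c) (hn : h + n ≤ N) :
    Measurable (pathReturn g h : (Fin n → Step S A) → ℝ) :=
  Finset.measurable_sum _ fun j _ =>
    (hg (h + j) (by omega)).measurable_uncurry.comp (measurable_pi_apply j).fst

theorem measurable_expectedReturn (hg : ∀ k < N, BoundedMeasurable (g k) c) (hn : h + n ≤ N)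
    (π : Policy S A) : Measurable (M.expectedReturn g π n h) :=
  (StronglyMeasurable.integral_kernel_prod_right' (κ := M.pathKernel π n h)
    (f := fun x : S × (Fin n → Step S A) => pathReturn g h x.2)
    ((measurable_pathReturn hg hn).comp measurable_snd).stronglyMeasurable).measurable

theorem integrable_expectedReturn (hg : ∀ k < N, BoundedMeasurable (g k) c) (hn : h + n ≤ N)
    (π : Policy S A) (k : ℕ) (x : S × A) :
    Integrable (fun q => M.expectedReturn g π n h q.2) (M.step k x) :=
  integrable_of_forall_abs_le ((M.measurable_expectedReturn hg hn π).comp measurable_snd)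
    fun q => M.abs_expectedReturn_le hg hn π q.2

theorem expectedReturn_succ (hg : ∀ k < N, BoundedMeasurable (g k) c) (hn : h + (n + 1) ≤ N)
    (π : Policy S A) (s : S) :
    M.expectedReturn g π (n + 1) h s = g h s (π.act h s) +
      ∫ q, M.expectedReturn g π n (h + 1) q.2 ∂M.step h (s, π.act h s) := by
  have hn' : h + 1 + n ≤ N := by omega
  have htail (q : ℝ × S) :
      ∫ τ, pathReturn g h (Fin.cons ((s, π.act h s), q) τ : Fin (n + 1) → Step S A)
        ∂M.pathKernel π n (h + 1) q.2 =
      g h s (π.act h s) + M.expectedReturn g π n (h + 1) q.2 := by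
    simp_rw [pathReturn_finCons]
    rw [integral_add (integrable_const _) (integrable_of_forall_abs_le
      (measurable_pathReturn hg hn') (abs_pathReturn_le hg hn'))]
    simp [expectedReturn]
  rw [expectedReturn, integral_pathKernel_succ M π n h s (measurable_pathReturn hg hn)
    (abs_pathReturn_le hg hn)]
  simp_rw [htail]
  rw [integral_add (integrable_const _) (M.integrable_expectedReturn hg hn' π _ _)]
  simp

end ExpectedReturn

section Performance

variable {S A : Type*} [MeasurableSpace S] [MeasurableSpace A] {M : MDP S A}

namespace BoundedRewards

theorem abs_value_le (hM : M.BoundedRewards) (π : Policy S A) (s : S) : |M.value π 0 s| ≤ M.H := by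
  rw [value_eq_expectedReturn, ← mul_one (M.H : ℝ)]
  exact M.abs_expectedReturn_le (fun _ => hM.boundedMeasurable_meanReward) (Nat.zero_add _).le π s

theorem value_le_optValue (hM : M.BoundedRewards) (π : Policy S A) (s : S) :
    M.value π 0 s ≤ M.optValue 0 s :=
  le_ciSup (f := fun π => M.value π 0 s)
    ⟨M.H, Set.forall_mem_range.2 fun π => (abs_le.1 (hM.abs_value_le π s)).2⟩ π

variable [Finite A]

theorem measurable_value [MeasurableSingletonClass A] (hM : M.BoundedRewards) (π : Policy S A) :
    Measurable (M.value π 0) :=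
  M.measurable_expectedReturn (fun _ => hM.boundedMeasurable_meanReward) (Nat.zero_add _).le π

variable [Nonempty A]

theorem exists_bellman_eq_self (hM : M.BoundedRewards) :
    ∃ (Q : QFun S A) (c : ℝ), (∀ h, BoundedMeasurable (Q h) c) ∧ Q M.H = 0 ∧
      ∀ h < M.H, M.bellman Q h = Q h := by
  suffices ∀ n ≤ M.H, ∃ (Q : QFun S A) (c : ℝ), (∀ h, BoundedMeasurable (Q h) c) ∧ Q M.H = 0 ∧
      ∀ h < M.H, M.H ≤ h + n → M.bellman Q h = Q h by
    obtain ⟨Q, c, hQ, hQH, hfix⟩ := this M.H le_rfl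
    exact ⟨Q, c, hQ, hQH, fun h hh => hfix h hh (Nat.le_add_left _ _)⟩
  intro n hn
  induction n with
  | zero => exact ⟨0, 0, fun h => ⟨fun _ => measurable_const, by simp⟩, rfl, by omega⟩
  | succ n ih =>
    obtain ⟨Q, c, hQ, hQH, hfix⟩ := ih (by omega)
    obtain ⟨k, hk⟩ : ∃ k, k + (n + 1) = M.H := ⟨M.H - (n + 1), by omega⟩
    have hbellman (h : ℕ) (hh : k ≤ h) :
        M.bellman (Function.update Q k (M.bellman Q k)) h = M.bellman Q h := by
      funext s a
      simp only [bellman, maxQ, Function.update_of_ne (show h + 1 ≠ k by omega)]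
    refine ⟨Function.update Q k (M.bellman Q k), max c (1 + c), fun h => ?_, ?_, ?_⟩
    · rcases eq_or_ne h k with rfl | hne
      · have hT := hM.boundedMeasurable_bellman (h := h) (by omega) (hQ (h + 1))
        rw [Function.update_self]
        exact ⟨hT.measurable, fun s a => (hT.abs_le s a).trans (le_max_right _ _)⟩
      · rw [Function.update_of_ne hne]
        exact ⟨(hQ h).measurable, fun s a => ((hQ h).abs_le s a).trans (le_max_left _ _)⟩
    · rw [Function.update_of_ne (by omega), hQH]
    · intro h hh hle
      rw [hbellman h (by omega)]
      rcases eq_or_ne h k with rfl | hne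
      · rw [Function.update_self]
      · rw [Function.update_of_ne hne, hfix h hh (by omega)]

variable [MeasurableSingletonClass A] {Q : QFun S A} {c : ℝ}

theorem maxQ_sub_expectedReturn (hM : M.BoundedRewards) (hQ : ∀ h, BoundedMeasurable (Q h) c)
    (hQH : Q M.H = 0) {π : Policy S A} (hπ : IsGreedy M.H Q π) {n h : ℕ} (hn : h + n = M.H)
    (s : S) :
    maxQ Q h s - M.expectedReturn M.meanReward π n h s =
      M.expectedReturn (bellmanError M Q) π n h s := by
  have hr := fun k (hk : k < M.H) => hM.boundedMeasurable_meanReward hk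
  have hE := fun k (hk : k < M.H) => hM.boundedMeasurable_bellmanError hQ hk
  induction n generalizing h s with
  | zero =>
    obtain rfl : h = M.H := by omega
    simp [expectedReturn, pathReturn, maxQ, hQH]
  | succ n ih =>
    have hn' : h + 1 + n = M.H := by omega
    rw [M.expectedReturn_succ hr hn.le, M.expectedReturn_succ hE hn.le]
    simp_rw [← ih hn']
    rw [integral_sub ((hQ (h + 1)).integrable_maxQ measurable_snd)
      (M.integrable_expectedReturn hr hn'.le π _ _),
      maxQ_eq_of_forall_le (hπ h (by omega) s)]
    simp only [bellmanError, bellman]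
    ring

theorem integral_maxQ_sub_value (hM : M.BoundedRewards) (hQ : ∀ h, BoundedMeasurable (Q h) c)
    (hQH : Q M.H = 0) {π : Policy S A} (hπ : IsGreedy M.H Q π) :
    ∫ s, (maxQ Q 0 s - M.value π 0 s) ∂M.ρ =
      ∫ τ, ∑ h : Fin M.H, bellmanError M Q h (τ h).1.1 (τ h).1.2 ∂M.law π := by
  have hE := fun k (hk : k < M.H) => hM.boundedMeasurable_bellmanError hQ hk
  have hreturn (τ : M.Traj) :
      ∑ h : Fin M.H, bellmanError M Q h (τ h).1.1 (τ h).1.2 =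
        pathReturn (bellmanError M Q) 0 τ := by
    simp only [pathReturn, Nat.zero_add]
  simp_rw [hreturn]
  rw [integral_law M π (measurable_pathReturn hE (Nat.zero_add _).le)
    (abs_pathReturn_le hE (Nat.zero_add _).le)]
  exact integral_congr_ae (ae_of_all _ fun s =>
    hM.maxQ_sub_expectedReturn hQ hQH hπ (Nat.zero_add _) s)

theorem expectedReturn_le_maxQ (hM : M.BoundedRewards) (hQ : ∀ h, BoundedMeasurable (Q h) c)
    (hQH : Q M.H = 0) (hfix : ∀ h < M.H, M.bellman Q h = Q h) (π : Policy S A) {n h : ℕ}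
    (hn : h + n = M.H) (s : S) : M.expectedReturn M.meanReward π n h s ≤ maxQ Q h s := by
  have hr := fun k (hk : k < M.H) => hM.boundedMeasurable_meanReward hk
  induction n generalizing h s with
  | zero =>
    obtain rfl : h = M.H := by omega
    simp [expectedReturn, pathReturn, maxQ, hQH]
  | succ n ih =>
    have hn' : h + 1 + n = M.H := by omega
    calc M.expectedReturn M.meanReward π (n + 1) h s
        = M.meanReward h s (π.act h s) +
            ∫ q, M.expectedReturn M.meanReward π n (h + 1) q.2 ∂M.step h (s, π.act h s) :=
          M.expectedReturn_succ hr hn.le π s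
      _ ≤ M.bellman Q h s (π.act h s) :=
          add_le_add_right (integral_mono (M.integrable_expectedReturn hr hn'.le π _ _)
            ((hQ (h + 1)).integrable_maxQ measurable_snd) fun q => ih hn' q.2) _
      _ = Q h s (π.act h s) := by rw [hfix h (by omega)]
      _ ≤ maxQ Q h s := le_maxQ Q h s _

theorem optValue_eq_maxQ (hM : M.BoundedRewards) (hQ : ∀ h, BoundedMeasurable (Q h) c)
    (hQH : Q M.H = 0) (hfix : ∀ h < M.H, M.bellman Q h = Q h) :
    M.optValue 0 = maxQ Q 0 := by
  obtain ⟨π₀, hπ₀⟩ := exists_greedy_policy fun h => (hQ h).measurable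
  have hBellmanError (n : ℕ) (hn : n = M.H) (s : S) :
      M.expectedReturn (bellmanError M Q) π₀ n 0 s = 0 := by
    have hzero (τ : Fin n → Step S A) : pathReturn (bellmanError M Q) 0 τ = 0 :=
      Finset.sum_eq_zero fun j _ => by rw [bellmanError, hfix _ (by omega), sub_self]
    simp_rw [expectedReturn, hzero, integral_zero]
  have : Nonempty (Policy S A) := ⟨π₀⟩
  funext s
  have hgreedy : M.value π₀ 0 s = maxQ Q 0 s := by
    have hgap := hM.maxQ_sub_expectedReturn hQ hQH (fun h _ => hπ₀ h) (Nat.zero_add M.H) s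
    rw [hBellmanError _ rfl] at hgap
    exact (sub_eq_zero.1 hgap).symm
  exact le_antisymm
    (ciSup_le fun π => hM.expectedReturn_le_maxQ hQ hQH hfix π (Nat.zero_add M.H) s)
    (hgreedy ▸ hM.value_le_optValue π₀ s)

theorem integrable_optValue (hM : M.BoundedRewards) : Integrable (M.optValue 0) M.ρ := by
  obtain ⟨Q, c, hQ, hQH, hfix⟩ := hM.exists_bellman_eq_self
  rw [hM.optValue_eq_maxQ hQ hQH hfix]
  exact (hQ 0).integrable_maxQ measurable_id

theorem integral_sub_optValue_le (hM : M.BoundedRewards) {V : S → ℝ} (hV : Integrable V M.ρ)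
    (π : Policy S A) :
    ∫ s, (V s - M.optValue 0 s) ∂M.ρ ≤ ∫ s, (V s - M.value π 0 s) ∂M.ρ :=
  integral_mono (hV.sub hM.integrable_optValue)
    (hV.sub (integrable_of_forall_abs_le (hM.measurable_value π) (hM.abs_value_le π)))
    fun s => sub_le_sub_left (hM.value_le_optValue π s) (V s)

end BoundedRewards

end Performance

end MDP

section Ridge

open Matrix

variable {d : ℕ}

theorem inner_eq_dotProduct (x y : EuclideanSpace ℝ (Fin d)) :
    (inner ℝ x y : ℝ) = x.ofLp ⬝ᵥ y.ofLp := by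
  rw [EuclideanSpace.inner_eq_star_dotProduct, dotProduct_comm, star_trivial]

theorem continuous_quad (G : Matrix (Fin d) (Fin d) ℝ) : Continuous (quad G) := by
  unfold quad
  fun_prop

theorem quad_nonneg {G : Matrix (Fin d) (Fin d) ℝ} (hG : G.PosSemidef)
    (x : EuclideanSpace ℝ (Fin d)) : 0 ≤ quad G x := by
  simpa only [quad, star_trivial] using hG.dotProduct_mulVec_nonneg x.ofLp

theorem quad_sub {G : Matrix (Fin d) (Fin d) ℝ} (hG : G.IsSymm) (x y : EuclideanSpace ℝ (Fin d)) :
    quad G (x - y) = quad G x - 2 * x.ofLp ⬝ᵥ (G *ᵥ y.ofLp) + quad G y := by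
  have hcomm : y.ofLp ⬝ᵥ (G *ᵥ x.ofLp) = x.ofLp ⬝ᵥ (G *ᵥ y.ofLp) := by
    rw [dotProduct_mulVec, ← mulVec_transpose, hG.eq, dotProduct_comm]
  simp only [quad, WithLp.ofLp_sub, mulVec_sub, dotProduct_sub, sub_dotProduct, hcomm]
  ring

theorem posDef_of_quad_pos {G : Matrix (Fin d) (Fin d) ℝ} (hG : G.IsSymm)
    (hpos : ∀ x : EuclideanSpace ℝ (Fin d), x ≠ 0 → 0 < quad G x) : G.PosDef := by
  refine PosDef.of_dotProduct_mulVec_pos ?_ fun v hv => ?_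
  · rwa [IsHermitian, conjTranspose_eq_transpose_of_trivial]
  · simpa only [quad, star_trivial] using hpos (WithLp.toLp 2 v) (by simpa using hv)

/-- The regularized empirical covariance of the first `n` feature vectors, the inverse of the
matrix `Σ⁻¹` that the algorithm updates. -/
def empCov (lam : ℝ) (z : ℕ → EuclideanSpace ℝ (Fin d)) (n : ℕ) : Matrix (Fin d) (Fin d) ℝ :=
  lam • 1 + ∑ i ∈ Finset.range n, vecMulVec (z i).ofLp (z i).ofLp

/-- The empirical correlation of the first `n` feature vectors and labels: the right-hand side of
the normal equations of ridge regression. -/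
def empMoment (z : ℕ → EuclideanSpace ℝ (Fin d)) (y : ℕ → ℝ) (n : ℕ) : Fin d → ℝ :=
  ∑ i ∈ Finset.range n, y i • (z i).ofLp

/-- The objective of ridge regression on the first `n` feature vectors and labels. -/
def ridgeLoss (lam : ℝ) (z : ℕ → EuclideanSpace ℝ (Fin d)) (y : ℕ → ℝ) (n : ℕ)
    (w : EuclideanSpace ℝ (Fin d)) : ℝ :=
  lam * ‖w‖ ^ 2 + ∑ i ∈ Finset.range n, (inner ℝ (z i) w - y i) ^ 2

variable {lam : ℝ} {z : ℕ → EuclideanSpace ℝ (Fin d)} {y : ℕ → ℝ} {n : ℕ}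

theorem empCov_succ : empCov lam z (n + 1) = empCov lam z n + vecMulVec (z n).ofLp (z n).ofLp := by
  simp only [empCov, Finset.sum_range_succ, add_assoc]

theorem isSymm_empCov : (empCov lam z n).IsSymm := by
  simp only [IsSymm, empCov, transpose_add, transpose_smul, transpose_one, transpose_sum,
    transpose_vecMulVec]

theorem quad_empCov (w : EuclideanSpace ℝ (Fin d)) :
    quad (empCov lam z n) w =
      lam * ‖w‖ ^ 2 + ∑ i ∈ Finset.range n, (inner ℝ (z i) w : ℝ) ^ 2 := by
  simp only [quad, empCov, add_mulVec, sum_mulVec, smul_mulVec, one_mulVec, vecMulVec_mulVec,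
    dotProduct_add, dotProduct_sum, dotProduct_smul, op_smul_eq_smul, ← inner_eq_dotProduct,
    real_inner_self_eq_norm_sq, smul_eq_mul, real_inner_comm, sq]

theorem posDef_empCov (hlam : 0 < lam) : (empCov lam z n).PosDef :=
  posDef_of_quad_pos isSymm_empCov fun w hw => by
    rw [quad_empCov]
    have := norm_pos_iff.2 hw
    positivity

theorem covUpdate_mul {P G : Matrix (Fin d) (Fin d) ℝ} (hP : P * G = 1)
    {x : EuclideanSpace ℝ (Fin d)} (hx : 0 ≤ quad P x) :
    covUpdate P x * (G + vecMulVec x.ofLp x.ofLp) = 1 := by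
  have hcov : vecMulVec (P *ᵥ x.ofLp) (x.ofLp ᵥ* P) * G = vecMulVec (P *ᵥ x.ofLp) x.ofLp := by
    rw [vecMulVec_mul, vecMul_vecMul, hP, vecMul_one]
  have hrankOne : vecMulVec (P *ᵥ x.ofLp) (x.ofLp ᵥ* P) * vecMulVec x.ofLp x.ofLp =
      quad P x • vecMulVec (P *ᵥ x.ofLp) x.ofLp := by
    rw [vecMulVec_mul_vecMulVec, quad, dotProduct_mulVec, vecMulVec_smul]
  have hne : (1 : ℝ) + quad P x ≠ 0 := by positivity
  rw [covUpdate, sub_mul, mul_add, mul_add, hP, mul_vecMulVec, smul_mul_assoc, smul_mul_assoc,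
    hcov, hrankOne]
  match_scalars <;> field_simp
  ring

theorem mulVec_paramUpdate {P G : Matrix (Fin d) (Fin d) ℝ} (hP : P * G = 1)
    {x θ : EuclideanSpace ℝ (Fin d)} (hx : 0 ≤ quad P x) (y : ℝ) :
    (G + vecMulVec x.ofLp x.ofLp) *ᵥ (paramUpdate θ P x (y - inner ℝ x θ)).ofLp =
      G *ᵥ θ.ofLp + y • x.ofLp := by
  have hne : (1 : ℝ) + quad P x ≠ 0 := by positivity
  have hupdate (k : ℝ) : (G + vecMulVec x.ofLp x.ofLp) *ᵥ (θ.ofLp + k • (P *ᵥ x.ofLp)) =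
      G *ᵥ θ.ofLp + (inner ℝ x θ + k * (1 + quad P x)) • x.ofLp := by
    rw [mulVec_add, add_mulVec, add_mulVec, mulVec_smul, mulVec_smul, mulVec_mulVec,
      mul_eq_one_comm.1 hP, one_mulVec, vecMulVec_mulVec, vecMulVec_mulVec, op_smul_eq_smul,
      op_smul_eq_smul, ← inner_eq_dotProduct, ← quad]
    module
  refine (hupdate _).trans ?_
  rw [div_mul_cancel₀ _ hne, add_sub_cancel]

theorem ridgeLoss_eq_quad_sub_add {θ : EuclideanSpace ℝ (Fin d)}
    (hθ : empCov lam z n *ᵥ θ.ofLp = empMoment z y n) (w : EuclideanSpace ℝ (Fin d)) :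
    ridgeLoss lam z y n w = quad (empCov lam z n) (w - θ) +
      (∑ i ∈ Finset.range n, y i ^ 2 - quad (empCov lam z n) θ) := by
  have hmoment : w.ofLp ⬝ᵥ empMoment z y n = ∑ i ∈ Finset.range n, inner ℝ (z i) w * y i := by
    simp only [empMoment, dotProduct_sum, dotProduct_smul, ← inner_eq_dotProduct, smul_eq_mul,
      real_inner_comm, mul_comm]
  rw [quad_sub isSymm_empCov, hθ, hmoment, quad_empCov w, ridgeLoss]
  simp only [sub_sq, Finset.sum_add_distrib, Finset.sum_sub_distrib, Finset.mul_sum, mul_assoc]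
  ring

theorem project_spec (G : Matrix (Fin d) (Fin d) ℝ) (θ : EuclideanSpace ℝ (Fin d)) :
    project G θ ∈ unitBall d ∧ IsMinOn (fun w => quad G (w - θ)) (unitBall d) (project G θ) := by
  have hmin : ∃ w, w ∈ unitBall d ∧ IsMinOn (fun w' => quad G (w' - θ)) (unitBall d) w :=
    (isCompact_closedBall 0 1).exists_isMinOn ⟨0, Metric.mem_closedBall_self zero_le_one⟩
      ((continuous_quad G).comp (continuous_sub_right θ)).continuousOn
  exact Classical.epsilon_spec hmin

theorem isMinOn_ridgeLoss_project {θ : EuclideanSpace ℝ (Fin d)}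
    (hθ : empCov lam z n *ᵥ θ.ofLp = empMoment z y n) :
    IsMinOn (ridgeLoss lam z y n) (unitBall d) (project (empCov lam z n) θ) := by
  intro w hw
  simp only [Set.mem_ofPred_eq, ridgeLoss_eq_quad_sub_add hθ]
  exact add_le_add_left ((project_spec (empCov lam z n) θ).2 hw) _

end Ridge

section RidgeState

open Matrix

variable {d : ℕ}

/-- The network parameter `θ` and inverse covariance `P` that recursive least squares attains after
the first `n` feature vectors `z` and labels `y`: `P` inverts the regularized covariance, and `θ`
solves the normal equations. -/
structure IsRidgeState (lam : ℝ) (z : ℕ → EuclideanSpace ℝ (Fin d)) (y : ℕ → ℝ) (n : ℕ)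
    (P : Matrix (Fin d) (Fin d) ℝ) (θ : EuclideanSpace ℝ (Fin d)) : Prop where
  mul_empCov : P * empCov lam z n = 1
  normal_eq : empCov lam z n *ᵥ θ.ofLp = empMoment z y n

namespace IsRidgeState

variable {lam : ℝ} {z : ℕ → EuclideanSpace ℝ (Fin d)} {y : ℕ → ℝ} {n : ℕ}
  {P : Matrix (Fin d) (Fin d) ℝ} {θ : EuclideanSpace ℝ (Fin d)}

theorem init (hlam : 0 < lam) (z : ℕ → EuclideanSpace ℝ (Fin d)) (y : ℕ → ℝ) :
    IsRidgeState lam z y 0 (lam • (1 : Matrix (Fin d) (Fin d) ℝ))⁻¹ 0 where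
  mul_empCov := by
    rw [empCov, Finset.range_zero, Finset.sum_empty, add_zero]
    refine Matrix.nonsing_inv_mul _ ?_
    rw [det_smul, det_one, mul_one]
    exact (IsUnit.mk0 _ hlam.ne').pow _
  normal_eq := by
    rw [WithLp.ofLp_zero, mulVec_zero, empMoment, Finset.range_zero, Finset.sum_empty]

theorem update (hlam : 0 < lam) (h : IsRidgeState lam z y n P θ) :
    IsRidgeState lam z y (n + 1) (covUpdate P (z n))
      (paramUpdate θ P (z n) (y n - inner ℝ (z n) θ)) := by
  have hP : P = (empCov lam z n)⁻¹ := (Matrix.inv_eq_left_inv h.mul_empCov).symm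
  have hquad : 0 ≤ quad P (z n) := hP ▸ quad_nonneg (posDef_empCov hlam).inv.posSemidef (z n)
  constructor
  · rw [empCov_succ]
    exact covUpdate_mul h.mul_empCov hquad
  · rw [empCov_succ, mulVec_paramUpdate h.mul_empCov hquad, h.normal_eq, empMoment, empMoment,
      Finset.sum_range_succ]

theorem isMinOn_project (h : IsRidgeState lam z y n P θ) :
    IsMinOn (ridgeLoss lam z y n) (unitBall d) (project P⁻¹ θ) := by
  rw [Matrix.inv_eq_right_inv h.mul_empCov]
  exact isMinOn_ridgeLoss_project h.normal_eq

end IsRidgeState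

end RidgeState

section Blocks

/-- The number of trajectories that the algorithm has used when it enters level `l` of epoch `e`:
the epochs `1, …, e - 1` use `H * (2 ^ e - 2)` of them, and each higher level of epoch `e` uses
`2 ^ e`. -/
def blockStart (H e l : ℕ) : ℕ := H * (2 ^ e - 2) + (H - 1 - l) * 2 ^ e

variable {H e : ℕ}

theorem blockStart_pred {l : ℕ} (hl : l < H) (hl0 : l ≠ 0) :
    blockStart H e l + 2 ^ e = blockStart H e (l - 1) := by
  have hlevels : H - 1 - (l - 1) = (H - 1 - l) + 1 := by omega
  rw [blockStart, blockStart, hlevels]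
  ring

theorem blockStart_succ (hH : 0 < H) (he : 1 ≤ e) :
    blockStart H e 0 + 2 ^ e = blockStart H (e + 1) (H - 1) := by
  obtain ⟨H, rfl⟩ := Nat.exists_eq_add_of_lt hH
  have htwo : 2 ≤ 2 ^ e := le_self_pow₀ one_le_two (by omega)
  have hdouble : 2 ^ e * 2 - 2 = 2 ^ e - 2 + 2 ^ e := by omega
  simp only [blockStart, pow_succ, hdouble, zero_add, Nat.add_sub_cancel, Nat.sub_zero,
    Nat.sub_self, Nat.zero_mul]
  ring

theorem blockStart_add_lt {l c : ℕ} (he : 1 ≤ e) (hl : l < H) (hc : c < 2 ^ e) :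
    blockStart H e l + c < H * (2 ^ (e + 1) - 2) := by
  have htwo : 2 ≤ 2 ^ e := le_self_pow₀ one_le_two (by omega)
  have hdouble : 2 ^ (e + 1) - 2 = 2 ^ e - 2 + 2 ^ e := by
    rw [pow_succ]
    omega
  have hlevels : (H - 1 - l + 1) * 2 ^ e ≤ H * 2 ^ e := Nat.mul_le_mul_right _ (by omega)
  rw [add_mul, one_mul] at hlevels
  rw [blockStart, hdouble, mul_add]
  omega

theorem div_le_two_pow_of_lt {K : ℕ} (hH : 0 < H) (hK : K < H * (2 ^ (e + 2) - 2)) :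
    (K : ℝ) / (4 * H) ≤ 2 ^ e := by
  have hK' : K ≤ H * (4 * 2 ^ e) := hK.le.trans (Nat.mul_le_mul_left _ (by rw [pow_add]; omega))
  rw [div_le_iff₀ (by positivity)]
  calc (K : ℝ) ≤ H * (4 * 2 ^ e) := by exact_mod_cast hK'
    _ = 2 ^ e * (4 * H) := by ring

theorem two_pow_le_of_le {K : ℕ} (hH : 0 < H) (he : 1 ≤ e) (hK : H * (2 ^ (e + 1) - 2) ≤ K) :
    (2 : ℝ) ^ e ≤ 4 * (K / (4 * H)) := by
  have htwo : 2 ≤ 2 ^ e := le_self_pow₀ one_le_two (by omega)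
  have hK' : H * 2 ^ e ≤ K := (Nat.mul_le_mul_left _ (by rw [pow_succ]; omega)).trans hK
  calc (2 : ℝ) ^ e = H * 2 ^ e / H := by field_simp
    _ ≤ K / H := by gcongr; exact_mod_cast hK'
    _ = 4 * (K / (4 * H)) := by field_simp

end Blocks

section Linear

variable {S A : Type*} [MeasurableSpace S] {d : ℕ} (F : Features S A d)

theorem Features.abs_lin_le_one {w : EuclideanSpace ℝ (Fin d)}
    (hw : w ∈ unitBall d) (h : ℕ) (s : S) (a : A) : |F.lin w h s a| ≤ 1 :=
  (abs_inner_le_of_norm_le_one (F.norm_φ_le h s a) w).trans (mem_closedBall_zero_iff.1 hw)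

theorem Features.abs_min_one_lin_add_le_one {b : QFun S A} (hb0 : ∀ h s a, 0 ≤ b h s a)
    {w : EuclideanSpace ℝ (Fin d)} (hw : w ∈ unitBall d) (h : ℕ) (s : S) (a : A) :
    |min 1 (F.lin w h s a + b h s a)| ≤ 1 :=
  abs_le.2 ⟨le_min (by norm_num)
    (by linarith [(abs_le.1 (F.abs_lin_le_one hw h s a)).1, hb0 h s a]), min_le_left _ _⟩

end Linear

section Run

variable {S A : Type*} [MeasurableSpace S] [MeasurableSpace A] (M : MDP S A) {d : ℕ}
  (F : Features S A d) (b : QFun S A) (lam : ℝ) (x : ℕ → M.Traj)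

/-- The `i`-th feature vector observed at stage `l`, counting from trajectory number `k` of the
stream on. -/
def seenFeature (l : Fin M.H) (k i : ℕ) : EuclideanSpace ℝ (Fin d) :=
  F.φ l (x (k + i) l).1.1 (x (k + i) l).1.2

/-- The regression label that goes with `seenFeature` when `Q` is the target network. -/
def seenLabel (Q : QFun S A) (l : Fin M.H) (k i : ℕ) : ℝ :=
  (x (k + i) l).2.1 + maxQ Q (l + 1) (x (k + i) l).2.2

/-- `Q l` is obtained by constrained ridge regression on the data of level `l` of epoch `e`, with
`Q` itself as the target network: the fixed-point relation that the algorithm establishes at every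
stage by the end of an epoch. -/
def IsFitted (e : ℕ) (l : Fin M.H) (Q : QFun S A) : Prop :=
  ∃ w ∈ unitBall d, (Q l = fun s a => min 1 (F.lin w l s a + b l s a)) ∧
    IsMinOn (ridgeLoss lam (seenFeature M F x l (blockStart M.H e l))
      (seenLabel M x Q l (blockStart M.H e l)) (2 ^ e)) (unitBall d) w

/-- What holds after `K` trajectories in a state that is working on level `l`, whether or not the
level has already received all of its `2 ^ epoch` trajectories. -/
structure LevelInvariant (K : ℕ) (st : State S A d) (l : Fin M.H) : Prop where
  level_eq : st.level = l
  one_le_epoch : 1 ≤ st.epoch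
  played : K = blockStart M.H st.epoch l + st.count
  regression : IsRidgeState lam (seenFeature M F x l (blockStart M.H st.epoch l))
    (seenLabel M x st.Qtar l (blockStart M.H st.epoch l)) st.count (st.covInv l) (st.θ l)
  target_mem : st.Qtar ∈ M.QAll
  best_mem : st.Qbest ∈ M.QAll
  fitted : ∀ j, l < j → IsFitted M F b lam x st.epoch j st.Qtar
  best_fitted : 2 ≤ st.epoch → ∀ j, IsFitted M F b lam x (st.epoch - 1) j st.Qbest

/-- The invariant of the algorithm between two rounds, after `K` trajectories. -/
def RunInvariant (K : ℕ) (st : State S A d) : Prop :=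
  st.count < 2 ^ st.epoch ∧ ∃ l, LevelInvariant M F b lam x K st l

variable {M F b lam x}

theorem IsFitted.congr {e : ℕ} {l : Fin M.H} {Q Q' : QFun S A} (h : IsFitted M F b lam x e l Q)
    (hl : Q' l = Q l) (hnext : Q' (l + 1) = Q (l + 1)) : IsFitted M F b lam x e l Q' := by
  have hlabel : seenLabel M x Q' l = seenLabel M x Q l := by
    funext k i
    simp only [seenLabel, maxQ, hnext]
  rw [IsFitted, hlabel, hl]
  exact h

theorem MDP.zero_mem_QAll : (0 : QFun S A) ∈ M.QAll :=
  ⟨fun _ _ => measurable_const, fun _ _ _ => by simp, rfl⟩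

theorem MDP.boundedMeasurable_of_mem_QAll {Q : QFun S A} (hQ : Q ∈ M.QAll) (h : ℕ) :
    BoundedMeasurable (Q h) 1 :=
  ⟨hQ.1 h, hQ.2.1 h⟩

theorem MDP.update_mem_QAll {Q : QFun S A} (hQ : Q ∈ M.QAll) {l : ℕ} (hl : l ≠ M.H)
    {f : S → A → ℝ} (hf : BoundedMeasurable f 1) : Function.update Q l f ∈ M.QAll := by
  have hbounded (h : ℕ) : BoundedMeasurable (Function.update Q l f h) 1 := by
    rcases eq_or_ne h l with rfl | hne
    · rwa [Function.update_self]
    · rw [Function.update_of_ne hne]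
      exact M.boundedMeasurable_of_mem_QAll hQ h
  exact ⟨fun h => (hbounded h).measurable, fun h => (hbounded h).abs_le,
    (Function.update_of_ne hl.symm _ _).trans hQ.2.2⟩

theorem levelInvariant_startLevel (hlam : 0 < lam) {K : ℕ} (st : State S A d) (l : Fin M.H)
    (he : 1 ≤ st.epoch) (hK : K = blockStart M.H st.epoch l) (htarget : st.Qtar ∈ M.QAll)
    (hbest : st.Qbest ∈ M.QAll) (hfit : ∀ j, l < j → IsFitted M F b lam x st.epoch j st.Qtar)
    (hbestFit : 2 ≤ st.epoch → ∀ j, IsFitted M F b lam x (st.epoch - 1) j st.Qbest) :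
    LevelInvariant M F b lam x K (startLevel lam st l) l where
  level_eq := rfl
  one_le_epoch := he
  played := hK
  regression := by
    simp only [startLevel, Function.update_self]
    exact .init hlam _ _
  target_mem := htarget
  best_mem := hbest
  fitted := hfit
  best_fitted := hbestFit

theorem runInvariant_initState (hlam : 0 < lam) :
    RunInvariant M F b lam x 0 (initState M lam) := by
  refine ⟨Nat.two_pow_pos _, ⟨M.H - 1, Nat.sub_lt M.H_pos one_pos⟩, ?_⟩
  rw [initState]
  refine levelInvariant_startLevel hlam _ ⟨M.H - 1, Nat.sub_lt M.H_pos one_pos⟩ le_rfl ?_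
    M.zero_mem_QAll M.zero_mem_QAll (fun j hj => ?_) fun h => ?_
  · simp [blockStart]
  · simp only [Fin.lt_def] at hj
    omega
  · simp at h

namespace LevelInvariant

variable {K : ℕ} {st : State S A d} {l : Fin M.H}

theorem playTrajectory (hlam : 0 < lam) (h : LevelInvariant M F b lam x K st l) :
    LevelInvariant M F b lam x (K + 1) (playTrajectory M F st (x K)) l where
  level_eq := h.level_eq
  one_le_epoch := h.one_le_epoch
  played := congrArg (· + 1) h.played
  regression := by
    have hupdate := h.regression.update hlam
    simp only [seenFeature, seenLabel, ← h.played] at hupdate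
    simp only [S3Q.playTrajectory, dif_pos l.isLt]
    exact hupdate
  target_mem := h.target_mem
  best_mem := h.best_mem
  fitted := h.fitted
  best_fitted := h.best_fitted

theorem updateTarget_mem_QAll (hb : ∀ h a, Measurable fun s => b h s a)
    (hb0 : ∀ h s a, 0 ≤ b h s a) (h : LevelInvariant M F b lam x K st l) :
    (updateTarget F b st).Qtar ∈ M.QAll := by
  refine M.update_mem_QAll h.target_mem (h.level_eq ▸ l.isLt.ne) ⟨fun a => ?_, ?_⟩
  · exact measurable_const.min (((F.measurable_φ _ a).inner measurable_const).add (hb _ a))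
  · exact F.abs_min_one_lin_add_le_one hb0 (project_spec _ _).1 _

theorem isFitted_updateTarget (h : LevelInvariant M F b lam x K st l)
    (hcount : st.count = 2 ^ st.epoch) {j : Fin M.H} (hj : l ≤ j) :
    IsFitted M F b lam x st.epoch j (updateTarget F b st).Qtar := by
  simp only [updateTarget, h.level_eq]
  rcases hj.eq_or_lt with rfl | hj
  · refine ⟨_, (project_spec _ _).1, Function.update_self _ _ _, ?_⟩
    have hmin := hcount ▸ h.regression.isMinOn_project
    have hlabel (f : S → A → ℝ) :
        seenLabel M x (Function.update st.Qtar l f) l = seenLabel M x st.Qtar l := by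
      funext k i
      simp only [seenLabel, maxQ, Function.update_of_ne (Nat.succ_ne_self (l : ℕ))]
    rwa [hlabel]
  · rw [Fin.lt_def] at hj
    exact (h.fitted j hj).congr (Function.update_of_ne (by omega) _ _)
      (Function.update_of_ne (by omega) _ _)

theorem startLevel_pred (hlam : 0 < lam) (hb : ∀ h a, Measurable fun s => b h s a)
    (hb0 : ∀ h s a, 0 ≤ b h s a) (h : LevelInvariant M F b lam x K st l)
    (hcount : st.count = 2 ^ st.epoch) (hl0 : (l : ℕ) ≠ 0) :
    LevelInvariant M F b lam x K (startLevel lam (updateTarget F b st) (l - 1))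
      ⟨l - 1, by omega⟩ := by
  refine levelInvariant_startLevel hlam _ ⟨l - 1, by omega⟩ h.one_le_epoch ?_
    (h.updateTarget_mem_QAll hb hb0) h.best_mem
    (fun j hj => h.isFitted_updateTarget hcount (Fin.le_def.2 ?_)) h.best_fitted
  · rw [h.played, hcount, blockStart_pred l.isLt hl0]
    rfl
  · simp only [Fin.lt_def] at hj
    omega

theorem startLevel_succ_epoch (hlam : 0 < lam) (hb : ∀ h a, Measurable fun s => b h s a)
    (hb0 : ∀ h s a, 0 ≤ b h s a) (h : LevelInvariant M F b lam x K st l)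
    (hcount : st.count = 2 ^ st.epoch) (hl0 : (l : ℕ) = 0) :
    LevelInvariant M F b lam x K
      (startLevel lam { updateTarget F b st with
        epoch := st.epoch + 1, Qbest := (updateTarget F b st).Qtar } (M.H - 1))
      ⟨M.H - 1, Nat.sub_lt M.H_pos one_pos⟩ := by
  have hQ := h.updateTarget_mem_QAll hb hb0
  refine levelInvariant_startLevel hlam _ ⟨M.H - 1, Nat.sub_lt M.H_pos one_pos⟩
    (Nat.le_add_left _ _) ?_ hQ hQ (fun j hj => ?_)
    fun _ j => h.isFitted_updateTarget hcount (Fin.le_def.2 (by omega))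
  · rw [h.played, hcount, hl0, blockStart_succ M.H_pos h.one_le_epoch]
  · simp only [Fin.lt_def] at hj
    omega

end LevelInvariant

theorem RunInvariant.round (hlam : 0 < lam) (hb : ∀ h a, Measurable fun s => b h s a)
    (hb0 : ∀ h s a, 0 ≤ b h s a) {K : ℕ} {st : State S A d}
    (hst : RunInvariant M F b lam x K st) :
    RunInvariant M F b lam x (K + 1) (round M F b lam st (x K)) := by
  obtain ⟨hcount, l, hl⟩ := hst
  have hplay := hl.playTrajectory hlam
  by_cases hlt : (playTrajectory M F st (x K)).count < 2 ^ (playTrajectory M F st (x K)).epoch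
  · rw [S3Q.round, if_pos hlt]
    exact ⟨hlt, l, hplay⟩
  have hfull : (playTrajectory M F st (x K)).count = 2 ^ (playTrajectory M F st (x K)).epoch :=
    le_antisymm hcount (not_lt.1 hlt)
  rw [S3Q.round, if_neg hlt]
  generalize playTrajectory M F st (x K) = st₁ at hplay hfull
  have hlevel : (updateTarget F b st₁).level = l := hplay.level_eq
  dsimp only
  rw [hlevel]
  split_ifs with hl0
  · exact ⟨Nat.two_pow_pos _, _, hplay.startLevel_succ_epoch hlam hb hb0 hfull hl0⟩
  · exact ⟨Nat.two_pow_pos _, _, hplay.startLevel_pred hlam hb hb0 hfull hl0⟩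

theorem runInvariant_run (hlam : 0 < lam) (hb : ∀ h a, Measurable fun s => b h s a)
    (hb0 : ∀ h s a, 0 ≤ b h s a) (K : ℕ) :
    RunInvariant M F b lam x K (run M F b lam x K) := by
  induction K with
  | zero => exact runInvariant_initState hlam
  | succ K ih => exact ih.round hlam hb hb0

theorem output_spec (hlam : 0 < lam) (hb : ∀ h a, Measurable fun s => b h s a)
    (hb0 : ∀ h s a, 0 ≤ b h s a) {K : ℕ} (hK : 2 * M.H ≤ K) :
    1 ≤ epochsCompleted M F b lam x K ∧
      (K : ℝ) / (4 * M.H) ≤ 2 ^ epochsCompleted M F b lam x K ∧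
      (2 : ℝ) ^ epochsCompleted M F b lam x K ≤ 4 * (K / (4 * M.H)) ∧
      output M F b lam x K ∈ M.QAll ∧
      ∀ l, IsFitted M F b lam x (epochsCompleted M F b lam x K) l (output M F b lam x K) := by
  obtain ⟨hcount, l, hl⟩ := runInvariant_run (M := M) (F := F) (x := x) hlam hb hb0 K
  have hlower : M.H * (2 ^ (run M F b lam x K).epoch - 2) ≤ K := by
    conv_rhs => rw [hl.played, blockStart, add_assoc]
    exact Nat.le_add_right _ _
  have hupper := hl.played.trans_lt (blockStart_add_lt hl.one_le_epoch l.isLt hcount)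
  obtain ⟨e, he⟩ : ∃ e, (run M F b lam x K).epoch = e + 1 :=
    Nat.exists_eq_add_of_le' hl.one_le_epoch
  have hone : 1 ≤ e := by
    by_contra hzero
    obtain rfl : e = 0 := by omega
    rw [he] at hupper
    omega
  have hbestFit := hl.best_fitted (by omega)
  rw [he] at hlower hupper
  simp only [epochsCompleted, output, he, Nat.add_sub_cancel] at hbestFit ⊢
  exact ⟨hone, div_le_two_pow_of_lt M.H_pos hupper, two_pow_le_of_le M.H_pos hone hlower,
    hl.best_mem, hbestFit⟩

end Run

section BestFit

open Filter Topology

theorem nonneg_of_forall_add_mul_nonneg {a b : ℝ} (h : ∀ t ∈ Set.Ioc (0 : ℝ) 1, 0 ≤ b + t * a) :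
    0 ≤ b := by
  have hlim : Tendsto (fun t : ℝ => b + t * a) (𝓝[>] 0) (𝓝 b) := by
    refine Tendsto.mono_left (Continuous.tendsto' (by fun_prop) 0 b (by simp)) nhdsWithin_le_nhds
  exact ge_of_tendsto hlim (eventually_of_mem (Ioc_mem_nhdsGT one_pos) h)

variable {X E : Type*} [MeasurableSpace X] [NormedAddCommGroup E] [InnerProductSpace ℝ E]
  {ν : Measure X} {φ : X → E} {g : X → ℝ}

theorem integral_inner_add_smul_sub_sq (hφ : ∀ v, MemLp (fun x => inner ℝ (φ x) v) 2 ν)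
    (hg : MemLp g 2 ν) (θ v : E) (t : ℝ) :
    ∫ x, (inner ℝ (φ x) (θ + t • v) - g x) ^ 2 ∂ν = ∫ x, (inner ℝ (φ x) θ - g x) ^ 2 ∂ν +
      t * (2 * ∫ x, inner ℝ (φ x) v * (inner ℝ (φ x) θ - g x) ∂ν +
        t * ∫ x, inner ℝ (φ x) v ^ 2 ∂ν) := by
  have hres := (hφ θ).sub hg
  have hcross : Integrable (fun x => inner ℝ (φ x) v * (inner ℝ (φ x) θ - g x)) ν :=
    (hφ v).integrable_mul hres
  have hexpand (x : X) : (inner ℝ (φ x) (θ + t • v) - g x) ^ 2 = (inner ℝ (φ x) θ - g x) ^ 2 +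
      (2 * t * (inner ℝ (φ x) v * (inner ℝ (φ x) θ - g x)) + t ^ 2 * inner ℝ (φ x) v ^ 2) := by
    rw [inner_add_right, inner_smul_right]
    ring
  have hsq : Integrable (fun x => (inner ℝ (φ x) θ - g x) ^ 2) ν := hres.integrable_sq
  have hlin := hcross.const_mul (2 * t)
  have hquad := (hφ v).integrable_sq.const_mul (t ^ 2)
  simp only [hexpand]
  rw [integral_add hsq (hlin.fun_add hquad), integral_add hlin hquad, integral_const_mul,
    integral_const_mul]
  ring

theorem integral_inner_mul_residual_nonneg_of_isMinOn
    (hφ : ∀ v, MemLp (fun x => inner ℝ (φ x) v) 2 ν) (hg : MemLp g 2 ν) {C : Set E}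
    (hC : Convex ℝ C) {θ θ₀ : E} (hθ : θ ∈ C) (hθ₀ : θ₀ ∈ C)
    (hmin : IsMinOn (fun w => ∫ x, (inner ℝ (φ x) w - g x) ^ 2 ∂ν) C θ₀) :
    0 ≤ ∫ x, inner ℝ (φ x) (θ - θ₀) * (inner ℝ (φ x) θ₀ - g x) ∂ν := by
  refine nonneg_of_mul_nonneg_right (nonneg_of_forall_add_mul_nonneg
    (a := ∫ x, inner ℝ (φ x) (θ - θ₀) ^ 2 ∂ν) fun t ht => ?_) two_pos
  have hle := hmin (hC.add_smul_sub_mem hθ₀ hθ ⟨ht.1.le, ht.2⟩)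
  simp only [Set.mem_ofPred_eq, integral_inner_add_smul_sub_sq hφ hg] at hle
  exact nonneg_of_mul_nonneg_right (le_add_iff_nonneg_right _ |>.1 hle) ht.1

theorem integral_sq_le_of_isMinOn (hφ : ∀ v, MemLp (fun x => inner ℝ (φ x) v) 2 ν)
    (hg : MemLp g 2 ν) {C : Set E} (hC : Convex ℝ C) {θ θ₀ : E} (hθ : θ ∈ C) (hθ₀ : θ₀ ∈ C)
    (hmin : IsMinOn (fun w => ∫ x, (inner ℝ (φ x) w - g x) ^ 2 ∂ν) C θ₀) :
    ∫ x, inner ℝ (φ x) (θ - θ₀) ^ 2 ∂ν ≤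
      ∫ x, inner ℝ (φ x) (θ - θ₀) * (inner ℝ (φ x) θ + inner ℝ (φ x) θ₀ - 2 * g x) ∂ν := by
  have hcross : Integrable (fun x => inner ℝ (φ x) (θ - θ₀) * (inner ℝ (φ x) θ₀ - g x)) ν :=
    (hφ _).integrable_mul ((hφ θ₀).sub hg)
  have hsplit (x : X) :
      inner ℝ (φ x) (θ - θ₀) * (inner ℝ (φ x) θ + inner ℝ (φ x) θ₀ - 2 * g x) =
        inner ℝ (φ x) (θ - θ₀) ^ 2 +
          2 * (inner ℝ (φ x) (θ - θ₀) * (inner ℝ (φ x) θ₀ - g x)) := by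
    rw [inner_sub_right]
    ring
  simp only [hsplit]
  rw [integral_add (hφ _).integrable_sq (hcross.const_mul _), integral_const_mul]
  linarith [integral_inner_mul_residual_nonneg_of_isMinOn hφ hg hC hθ hθ₀ hmin]

end BestFit

section QuadraticForm

open Matrix

variable {d : ℕ}

theorem abs_inner_le_sqrt_quad_mul {G : Matrix (Fin d) (Fin d) ℝ} (hG : G.PosDef)
    (x v : EuclideanSpace ℝ (Fin d)) : |inner ℝ x v| ≤ √(quad G⁻¹ x) * √(quad G v) := by
  have hsymm : G.IsSymm := (conjTranspose_eq_transpose_of_trivial G).symm.trans hG.isHermitian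
  have hGx : G *ᵥ (G⁻¹ *ᵥ x.ofLp) = x.ofLp := by
    rw [mulVec_mulVec, mul_nonsing_inv _ ((isUnit_iff_isUnit_det G).1 hG.isUnit), one_mulVec]
  have hnonneg (t : ℝ) : 0 ≤ quad G⁻¹ x * (t * t) + -2 * inner ℝ x v * t + quad G v := by
    have hquad := quad_nonneg hG.posSemidef (v - t • WithLp.toLp 2 (G⁻¹ *ᵥ x.ofLp))
    rw [quad_sub hsymm] at hquad
    simp only [quad, WithLp.ofLp_smul, mulVec_smul, hGx, dotProduct_smul, smul_dotProduct,
      smul_eq_mul] at hquad ⊢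
    rw [inner_eq_dotProduct, dotProduct_comm x.ofLp v.ofLp, dotProduct_comm x.ofLp (_ *ᵥ _)]
    linarith
  have hdiscrim := discrim_le_zero hnonneg
  rw [discrim] at hdiscrim
  rw [← Real.sqrt_mul (quad_nonneg hG.inv.posSemidef x)]
  exact Real.abs_le_sqrt (by linarith)

theorem quad_smul_add_smul_one (n lam : ℝ) (G : Matrix (Fin d) (Fin d) ℝ)
    (v : EuclideanSpace ℝ (Fin d)) : quad (n • G + lam • 1) v = n * quad G v + lam * ‖v‖ ^ 2 := by
  rw [quad, add_mulVec, smul_mulVec, smul_mulVec, one_mulVec, dotProduct_add, dotProduct_smul,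
    dotProduct_smul, ← inner_eq_dotProduct v v, real_inner_self_eq_norm_sq]
  rfl

theorem quad_integral_mul {X : Type*} [MeasurableSpace X] {μ : Measure X}
    {Z : X → EuclideanSpace ℝ (Fin d)}
    (hZ : ∀ i j, Integrable (fun x => (Z x).ofLp i * (Z x).ofLp j) μ)
    (v : EuclideanSpace ℝ (Fin d)) :
    quad (of fun i j => ∫ x, (Z x).ofLp i * (Z x).ofLp j ∂μ) v = ∫ x, inner ℝ (Z x) v ^ 2 ∂μ := by
  have hexpand (x : X) : inner ℝ (Z x) v ^ 2 =
      ∑ i, ∑ j, v.ofLp i * (v.ofLp j * ((Z x).ofLp i * (Z x).ofLp j)) := by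
    rw [inner_eq_dotProduct, dotProduct, sq, Finset.sum_mul_sum]
    exact Finset.sum_congr rfl fun i _ => Finset.sum_congr rfl fun j _ => by ring
  have hterm (i j : Fin d) :
      Integrable (fun x => v.ofLp i * (v.ofLp j * ((Z x).ofLp i * (Z x).ofLp j))) μ :=
    ((hZ i j).const_mul _).const_mul _
  simp only [hexpand]
  rw [integral_finsetSum _ fun i _ => integrable_finsetSum _ fun j _ => hterm i j]
  simp only [quad, dotProduct, mulVec, of_apply, Finset.mul_sum,
    integral_finsetSum _ fun j _ => hterm _ j, integral_const_mul]
  exact Finset.sum_congr rfl fun i _ => Finset.sum_congr rfl fun j _ => by ring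

end QuadraticForm

section ExpectedCovariance

variable {S A : Type*} [MeasurableSpace S] [MeasurableSpace A]

theorem MDP.expect_eq_integral_map {M : MDP S A} (μ : Measure M.Traj) (h : Fin M.H)
    {f : S → A → ℝ} (hf : Measurable fun x : S × A => f x.1 x.2) :
    M.expect μ h f = ∫ x, f x.1 x.2 ∂μ.map (fun τ => (τ h).1) :=
  (integral_map (measurable_pi_apply h).fst.aemeasurable hf.aestronglyMeasurable).symm

variable [Countable A] [MeasurableSingletonClass A] {M : MDP S A} {d : ℕ}

theorem Features.measurable_uncurry (F : Features S A d) (h : ℕ) :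
    Measurable fun x : S × A => F.φ h x.1 x.2 :=
  measurable_from_prod_countable_left (F.measurable_φ h)

theorem quad_expectedCov (F : Features S A d) (π : Controller S A) (lam n : ℝ) (h : Fin M.H)
    (v : EuclideanSpace ℝ (Fin d)) :
    quad (expectedCov M F π lam n h) v =
      n * M.expect (M.controllerLaw π) h (fun s a => inner ℝ (F.φ h s a) v ^ 2) +
        lam * ‖v‖ ^ 2 := by
  have hcoord (i : Fin d) :
      Measurable fun τ : M.Traj => (F.φ h (τ h).1.1 (τ h).1.2).ofLp i :=
    (EuclideanSpace.proj (𝕜 := ℝ) i).continuous.measurable.comp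
      ((F.measurable_uncurry h).comp (measurable_pi_apply h).fst)
  have hcoord_le (i : Fin d) (τ : M.Traj) : |(F.φ h (τ h).1.1 (τ h).1.2).ofLp i| ≤ 1 :=
    (PiLp.norm_apply_le (F.φ h (τ h).1.1 (τ h).1.2) i).trans (F.norm_φ_le _ _ _)
  rw [expectedCov, quad_smul_add_smul_one]
  congr 2
  refine quad_integral_mul (Z := fun τ : M.Traj => F.φ h (τ h).1.1 (τ h).1.2) (fun i j => ?_) v
  refine integrable_of_forall_abs_le ((hcoord i).mul (hcoord j)) (c := 1) fun τ => ?_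
  rw [abs_mul]
  exact mul_le_one₀ (hcoord_le i τ) (abs_nonneg _) (hcoord_le j τ)

theorem posDef_expectedCov (F : Features S A d) (π : Controller S A) {lam n : ℝ}
    (hlam : 0 < lam) (hn : 0 ≤ n) (h : Fin M.H) : (expectedCov M F π lam n h).PosDef := by
  refine posDef_of_quad_pos (Matrix.IsSymm.ext fun i j => ?_) fun v hv => ?_
  · simp only [expectedCov, Matrix.add_apply, Matrix.smul_apply, Matrix.of_apply, Matrix.one_apply,
      eq_comm (a := i) (b := j), mul_comm]
  · have hexpect : 0 ≤ M.expect (M.controllerLaw π) h fun s a => inner ℝ (F.φ h s a) v ^ 2 :=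
      integral_nonneg fun _ => sq_nonneg _
    have := norm_pos_iff.2 hv
    rw [quad_expectedCov]
    positivity

end ExpectedCovariance

section ParametricTarget

variable {S A : Type*} [MeasurableSpace S] {d : ℕ} (H : ℕ) (F : Features S A d) (b : QFun S A)

/-- The target network determined by the parameter `w`.  The targets of the algorithm use one
parameter per stage; as a regression label involves one stage only, the same `w` serves for all. -/
def parametricTarget (w : EuclideanSpace ℝ (Fin d)) : QFun S A := fun h s a =>
  if h < H then min 1 (F.lin w h s a + b h s a) else 0

/-- The regression label of a step at stage `h` for the target network with parameter `w`.  The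
reward is clipped, which changes it only on a null set, so that labels are bounded everywhere. -/
def parametricLabel (h : ℕ) (w : EuclideanSpace ℝ (Fin d)) (x : Step S A) : ℝ :=
  max (-1) (min 1 x.2.1) + maxQ (parametricTarget H F b w) (h + 1) x.2.2

theorem abs_clip_le_one (r : ℝ) : |max (-1) (min 1 r)| ≤ 1 :=
  abs_le.2 ⟨le_max_left _ _, max_le (by norm_num) (min_le_left _ _)⟩

theorem clip_eq_self {r : ℝ} (hr : |r| ≤ 1) : max (-1) (min 1 r) = r := by
  rw [min_eq_right (abs_le.1 hr).2, max_eq_right (abs_le.1 hr).1]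

variable {b}

theorem abs_parametricTarget_le_one (hb0 : ∀ h s a, 0 ≤ b h s a) {w : EuclideanSpace ℝ (Fin d)}
    (hw : w ∈ unitBall d) (h : ℕ) (s : S) (a : A) : |parametricTarget H F b w h s a| ≤ 1 := by
  unfold parametricTarget
  split_ifs
  · exact F.abs_min_one_lin_add_le_one hb0 hw h s a
  · simp

variable (b) in
theorem abs_parametricTarget_sub_le (w w' : EuclideanSpace ℝ (Fin d)) (h : ℕ) (s : S) (a : A) :
    |parametricTarget H F b w h s a - parametricTarget H F b w' h s a| ≤ ‖w - w'‖ := by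
  unfold parametricTarget
  split_ifs
  · refine (abs_min_sub_min_le_max _ _ _ _).trans (max_le (by simp) ?_)
    rw [add_sub_add_right_eq_sub, Features.lin, Features.lin, ← inner_sub_right]
    exact abs_inner_le_of_norm_le_one (F.norm_φ_le _ _ _) _
  · simp

variable [Finite A]

theorem measurable_parametricLabel [MeasurableSpace A] (hb : ∀ h a, Measurable fun s => b h s a)
    (h : ℕ) : Measurable (Function.uncurry (parametricLabel H F b h)) := by
  refine (measurable_const.max (measurable_const.min measurable_snd.snd.fst)).add
    (Measurable.iSup fun a => ?_)
  unfold parametricTarget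
  split_ifs
  · have hs : Measurable fun q : EuclideanSpace ℝ (Fin d) × Step S A => q.2.2.2 :=
      measurable_snd.snd.snd
    exact measurable_const.min ((((F.measurable_φ (h + 1) a).comp hs).inner measurable_fst).add
      ((hb (h + 1) a).comp hs))
  · exact measurable_const

variable [Nonempty A]

theorem abs_parametricLabel_le_two (hb0 : ∀ h s a, 0 ≤ b h s a) (h : ℕ)
    {w : EuclideanSpace ℝ (Fin d)} (hw : w ∈ unitBall d) (x : Step S A) :
    |parametricLabel H F b h w x| ≤ 2 :=
  (abs_add_le _ _).trans <| (add_le_add (abs_clip_le_one x.2.1) <|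
    abs_maxQ_le (abs_parametricTarget_le_one H F hb0 hw (h + 1) x.2.2)).trans (by norm_num)

variable (b) in
theorem abs_parametricLabel_sub_le (h : ℕ) (w w' : EuclideanSpace ℝ (Fin d)) (x : Step S A) :
    |parametricLabel H F b h w x - parametricLabel H F b h w' x| ≤ ‖w - w'‖ := by
  rw [parametricLabel, parametricLabel, add_sub_add_left_eq_sub]
  exact abs_maxQ_sub_maxQ_le (abs_parametricTarget_sub_le H F b w w' (h + 1) x.2.2)

end ParametricTarget

section ConditionalExpectation

variable {S A : Type*} [MeasurableSpace S] [MeasurableSpace A] {M : MDP S A} {d : ℕ}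
  {F : Features S A d} {b Q : QFun S A}

theorem exists_maxQ_eq_maxQ_parametricTarget {lam : ℝ} {x : ℕ → M.Traj} {e : ℕ} (hQ : Q ∈ M.QAll)
    (hfit : ∀ l, IsFitted M F b lam x e l Q) (h : Fin M.H) :
    ∃ w ∈ unitBall d, maxQ Q (h + 1) = maxQ (parametricTarget M.H F b w) (h + 1) := by
  by_cases hh : (h : ℕ) + 1 < M.H
  · obtain ⟨w, hw, hQw, -⟩ := hfit ⟨h + 1, hh⟩
    refine ⟨w, hw, ?_⟩
    unfold maxQ parametricTarget
    simp only [if_pos hh, hQw]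
  · have hlast : (h : ℕ) + 1 = M.H := by omega
    refine ⟨0, Metric.mem_closedBall_self zero_le_one, ?_⟩
    unfold maxQ parametricTarget
    simp only [hlast, hQ.2.2, Pi.zero_apply, lt_irrefl, if_false]

variable [Finite A] [Nonempty A] {h : Fin M.H} {w θ θ₀ : EuclideanSpace ℝ (Fin d)}

theorem integral_parametricLabel_step (hM : M.BoundedRewards) (hQ : BoundedMeasurable (Q (h + 1)) 1)
    (hw : maxQ Q (h + 1) = maxQ (parametricTarget M.H F b w) (h + 1)) (x : S × A) :
    ∫ q, parametricLabel M.H F b h w (x, q) ∂M.step h x = M.bellman Q h x.1 x.2 := by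
  have hclip : ∀ᵐ q ∂M.step h x, max (-1) (min 1 q.1) = q.1 := by
    filter_upwards [hM h h.2 x.1 x.2] with q hq using clip_eq_self hq
  have hclip_int : Integrable (fun q : ℝ × S => max (-1) (min 1 q.1)) (M.step h x) :=
    integrable_of_forall_abs_le (measurable_const.max (measurable_const.min measurable_fst))
      fun q => abs_clip_le_one q.1
  simp only [parametricLabel, ← hw]
  rw [integral_add hclip_int (hQ.integrable_maxQ measurable_snd), integral_congr_ae hclip,
    MDP.bellman, MDP.meanReward]

theorem integral_excessLoss_step (hM : M.BoundedRewards) (hb : ∀ h a, Measurable fun s => b h s a)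
    (hb0 : ∀ h s a, 0 ≤ b h s a) (hQ : BoundedMeasurable (Q (h + 1)) 1) (hwB : w ∈ unitBall d)
    (hw : maxQ Q (h + 1) = maxQ (parametricTarget M.H F b w) (h + 1)) (x : S × A) :
    ∫ q, excessLoss (fun x : Step S A => F.φ h x.1.1 x.1.2) (parametricLabel M.H F b h)
        (w, θ, θ₀) (x, q) ∂M.step h x =
      inner ℝ (F.φ h x.1 x.2) (θ - θ₀) * (inner ℝ (F.φ h x.1 x.2) θ +
        inner ℝ (F.φ h x.1 x.2) θ₀ - 2 * M.bellman Q h x.1 x.2) := by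
  have hlabel : Measurable (parametricLabel M.H F b h w) :=
    (measurable_parametricLabel M.H F hb h).of_uncurry_left
  have hlabel_int : Integrable (fun q => parametricLabel M.H F b h w (x, q)) (M.step h x) :=
    integrable_of_forall_abs_le (hlabel.comp measurable_prodMk_left)
      fun q => abs_parametricLabel_le_two M.H F hb0 h hwB _
  have hexpand (q : ℝ × S) : excessLoss (fun x : Step S A => F.φ h x.1.1 x.1.2)
      (parametricLabel M.H F b h) (w, θ, θ₀) (x, q) =
        inner ℝ (F.φ h x.1 x.2) (θ - θ₀) *
          (inner ℝ (F.φ h x.1 x.2) θ + inner ℝ (F.φ h x.1 x.2) θ₀) -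
        2 * inner ℝ (F.φ h x.1 x.2) (θ - θ₀) * parametricLabel M.H F b h w (x, q) := by
    simp only [excessLoss]
    rw [inner_sub_right]
    ring
  simp only [hexpand]
  rw [integral_sub (integrable_const _) (hlabel_int.const_mul _), integral_const,
    integral_const_mul, integral_parametricLabel_step hM hQ hw, probReal_univ, one_smul]
  ring

variable [MeasurableSingletonClass A] {π : Controller S A}

theorem integral_excessLoss (hM : M.BoundedRewards) (hb : ∀ h a, Measurable fun s => b h s a)
    (hb0 : ∀ h s a, 0 ≤ b h s a) (hQ : BoundedMeasurable (Q (h + 1)) 1) (hwB : w ∈ unitBall d)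
    (hw : maxQ Q (h + 1) = maxQ (parametricTarget M.H F b w) (h + 1)) (hθ : θ ∈ unitBall d)
    (hθ₀ : θ₀ ∈ unitBall d) :
    ∫ x, excessLoss (fun x : Step S A => F.φ h x.1.1 x.1.2) (parametricLabel M.H F b h)
        (w, θ, θ₀) x ∂(M.controllerLaw π).map (fun τ => τ h) =
      ∫ x, inner ℝ (F.φ h x.1 x.2) (θ - θ₀) * (inner ℝ (F.φ h x.1 x.2) θ +
        inner ℝ (F.φ h x.1 x.2) θ₀ - 2 * M.bellman Q h x.1 x.2)
        ∂(M.controllerLaw π).map fun τ => (τ h).1 := by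
  have heval : Measurable fun τ : M.Traj => (τ h).1 := (measurable_pi_apply h).fst
  have : IsProbabilityMeasure ((M.controllerLaw π).map fun τ => (τ h).1) :=
    Measure.isProbabilityMeasure_map heval.aemeasurable
  have hloss : Measurable (excessLoss (fun x : Step S A => F.φ h x.1.1 x.1.2)
      (parametricLabel M.H F b h) (w, θ, θ₀)) :=
    (measurable_uncurry_excessLoss ((F.measurable_uncurry h).comp measurable_fst)
      (measurable_parametricLabel M.H F hb h)).of_uncurry_left
  rw [MDP.map_controllerLaw_step, Measure.integral_compProd (integrable_of_forall_abs_le hloss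
    fun x => abs_excessLoss_le_twelve (F.norm_φ_le h x.1.1 x.1.2)
      (abs_parametricLabel_le_two M.H F hb0 h hwB x) (mem_closedBall_zero_iff.1 hθ)
      (mem_closedBall_zero_iff.1 hθ₀))]
  simp only [integral_excessLoss_step hM hb hb0 hQ hwB hw]

theorem IsBestPredictor.expect_sq_le (hM : M.BoundedRewards) (hQ : BoundedMeasurable (Q (h + 1)) 1)
    (hθ : θ ∈ unitBall d) (hθ₀ : IsBestPredictor M F π Q h θ₀) :
    M.expect (M.controllerLaw π) h (fun s a => inner ℝ (F.φ h s a) (θ - θ₀) ^ 2) ≤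
      ∫ x, inner ℝ (F.φ h x.1 x.2) (θ - θ₀) * (inner ℝ (F.φ h x.1 x.2) θ +
        inner ℝ (F.φ h x.1 x.2) θ₀ - 2 * M.bellman Q h x.1 x.2)
        ∂(M.controllerLaw π).map fun τ => (τ h).1 := by
  have heval : Measurable fun τ : M.Traj => (τ h).1 := (measurable_pi_apply h).fst
  have : IsProbabilityMeasure ((M.controllerLaw π).map fun τ => (τ h).1) :=
    Measure.isProbabilityMeasure_map heval.aemeasurable
  have hbellman := hM.boundedMeasurable_bellman h.2 hQ
  have hlin (v : EuclideanSpace ℝ (Fin d)) :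
      Measurable fun x : S × A => inner ℝ (F.φ h x.1 x.2) v :=
    (F.measurable_uncurry h).inner measurable_const
  have hmin : IsMinOn (fun v => ∫ x, (F.lin v h x.1 x.2 - M.bellman Q h x.1 x.2) ^ 2
      ∂(M.controllerLaw π).map fun τ => (τ h).1) (unitBall d) θ₀ := by
    have hloss (v : EuclideanSpace ℝ (Fin d)) := MDP.expect_eq_integral_map (M.controllerLaw π) h
      (f := fun s a => (F.lin v h s a - M.bellman Q h s a) ^ 2)
      (((hlin v).sub hbellman.measurable_uncurry).pow_const 2)
    simpa only [hloss] using hθ₀.2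
  rw [MDP.expect_eq_integral_map _ h (f := fun s a => inner ℝ (F.φ h s a) (θ - θ₀) ^ 2)
    ((hlin _).pow_const 2)]
  exact integral_sq_le_of_isMinOn
    (fun v => .of_bound (hlin v).aestronglyMeasurable ‖v‖ <|
      ae_of_all _ fun x => abs_inner_le_of_norm_le_one (F.norm_φ_le h x.1 x.2) v)
    (.of_bound hbellman.measurable_uncurry.aestronglyMeasurable (1 + 1) <|
      ae_of_all _ fun x => hbellman.abs_le x.1 x.2)
    (convex_closedBall 0 1) hθ hθ₀.1 hmin

theorem IsBestPredictor.expect_sq_le_integral_excessLoss (hM : M.BoundedRewards)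
    (hb : ∀ h a, Measurable fun s => b h s a) (hb0 : ∀ h s a, 0 ≤ b h s a)
    (hQ : BoundedMeasurable (Q (h + 1)) 1) (hwB : w ∈ unitBall d)
    (hw : maxQ Q (h + 1) = maxQ (parametricTarget M.H F b w) (h + 1)) (hθ : θ ∈ unitBall d)
    (hθ₀ : IsBestPredictor M F π Q h θ₀) :
    M.expect (M.controllerLaw π) h (fun s a => inner ℝ (F.φ h s a) (θ - θ₀) ^ 2) ≤
      ∫ x, excessLoss (fun x : Step S A => F.φ h x.1.1 x.1.2) (parametricLabel M.H F b h)
        (w, θ, θ₀) x ∂(M.controllerLaw π).map (fun τ => τ h) :=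
  (hθ₀.expect_sq_le hM hQ hθ).trans_eq (integral_excessLoss hM hb hb0 hQ hwB hw hθ hθ₀.1).symm

end ConditionalExpectation

section FittedTargets

variable {S A Ω : Type*} [MeasurableSpace S] [MeasurableSpace A] [MeasurableSpace Ω] {M : MDP S A}
  {d : ℕ} {F : Features S A d} {b : QFun S A} {lam : ℝ} {π : Controller S A}

theorem sum_sq_sub_sq_le_of_isMinOn_ridgeLoss {z : ℕ → EuclideanSpace ℝ (Fin d)} {y : ℕ → ℝ}
    {n : ℕ} {w θ : EuclideanSpace ℝ (Fin d)} (hlam : 0 ≤ lam)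
    (hw : IsMinOn (ridgeLoss lam z y n) (unitBall d) w) (hθ : θ ∈ unitBall d) :
    ∑ i ∈ Finset.range n, ((inner ℝ (z i) w - y i) ^ 2 - (inner ℝ (z i) θ - y i) ^ 2) ≤ lam := by
  have hle : ridgeLoss lam z y n w ≤ ridgeLoss lam z y n θ := hw hθ
  have hpenalty : lam * ‖θ‖ ^ 2 ≤ lam :=
    mul_le_of_le_one_right hlam (pow_le_one₀ (norm_nonneg _) (mem_closedBall_zero_iff.1 hθ))
  have hnonneg : 0 ≤ lam * ‖w‖ ^ 2 := by positivity
  rw [ridgeLoss, ridgeLoss] at hle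
  rw [Finset.sum_sub_distrib]
  linarith

theorem excessLoss_parametricLabel {x : ℕ → M.Traj} {l : Fin M.H} {k i : ℕ} {Q : QFun S A}
    {w : EuclideanSpace ℝ (Fin d)} (hr : |(x (k + i) l).2.1| ≤ 1)
    (hw : maxQ Q (l + 1) = maxQ (parametricTarget M.H F b w) (l + 1))
    (u v : EuclideanSpace ℝ (Fin d)) :
    excessLoss (fun x : Step S A => F.φ l x.1.1 x.1.2) (parametricLabel M.H F b l) (w, u, v)
        (x (k + i) l) =
      (inner ℝ (seenFeature M F x l k i) u - seenLabel M x Q l k i) ^ 2 -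
        (inner ℝ (seenFeature M F x l k i) v - seenLabel M x Q l k i) ^ 2 := by
  simp only [excessLoss, parametricLabel, clip_eq_self hr, seenFeature, seenLabel, hw]

theorem sum_excessLoss_le_of_isMinOn_ridgeLoss {x : ℕ → M.Traj} {l : Fin M.H} {k n : ℕ}
    {Q : QFun S A} {w w' θ : EuclideanSpace ℝ (Fin d)} (hlam : 0 ≤ lam)
    (hr : ∀ i, |(x i l).2.1| ≤ 1)
    (hw' : maxQ Q (l + 1) = maxQ (parametricTarget M.H F b w') (l + 1))
    (hw : IsMinOn (ridgeLoss lam (seenFeature M F x l k) (seenLabel M x Q l k) n) (unitBall d) w)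
    (hθ : θ ∈ unitBall d) :
    ∑ i : Fin n, excessLoss (fun x : Step S A => F.φ l x.1.1 x.1.2) (parametricLabel M.H F b l)
      (w', w, θ) (x (k + i) l) ≤ lam := by
  simp only [excessLoss_parametricLabel (hr _) hw']
  rw [Fin.sum_univ_eq_sum_range fun i =>
    (inner ℝ (seenFeature M F x l k i) w - seenLabel M x Q l k i) ^ 2 -
      (inner ℝ (seenFeature M F x l k i) θ - seenLabel M x Q l k i) ^ 2]
  exact sum_sq_sub_sq_le_of_isMinOn_ridgeLoss hlam hw hθ

theorem iIndepFun_comp_add {X Y : Type*} [MeasurableSpace X] [MeasurableSpace Y] {P : Measure Ω}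
    {ξ : ℕ → Ω → X} (hind : iIndepFun ξ P) {g : X → Y} (hg : Measurable g) (k n : ℕ) :
    iIndepFun (fun (i : Fin n) ω => g (ξ (k + i) ω)) P :=
  (hind.precomp (g := fun i : Fin n => k + (i : ℕ)) fun _ _ hij =>
    Fin.ext (Nat.add_left_cancel hij)).comp (fun _ => g) fun _ => hg

/-- The guarantee for the on-policy mean squared distance between a regression parameter and a best
on-policy fit after `n` samples, with failure probability `t`.  The dimension is counted three
times, for the regression parameter, the best fit and the target network. -/
def fitError (d : ℕ) (lam n t : ℝ) : ℝ :=
  (2 * lam + 192 * (2 + 3 * d * Real.log n + Real.log t⁻¹)) / n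

variable (M F b π) in
/-- `Q l` is the target network of a parameter whose on-policy mean squared distance to every best
on-policy fit at stage `l` is at most `r`. -/
def IsCloseToBestFits (l : Fin M.H) (r : ℝ) (Q : QFun S A) : Prop :=
  ∃ w ∈ unitBall d, (Q l = fun s a => min 1 (F.lin w l s a + b l s a)) ∧
    ∀ θ, IsBestPredictor M F π Q l θ →
      M.expect (M.controllerLaw π) l (fun s a => inner ℝ (F.φ l s a) (w - θ) ^ 2) ≤ r

theorem MDP.expect_eq_integral_map_step (μ : Measure M.Traj) (h : Fin M.H)
    {f : S → A → ℝ} (hf : Measurable fun x : S × A => f x.1 x.2) :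
    M.expect μ h f = ∫ x, f x.1.1 x.1.2 ∂μ.map (fun τ => τ h) :=
  (integral_map (φ := fun τ : M.Traj => τ h) (f := fun x : Step S A => f x.1.1 x.1.2)
    (measurable_pi_apply h).aemeasurable (hf.comp measurable_fst).aestronglyMeasurable).symm

variable {P : Measure Ω} {ξ : ℕ → Ω → M.Traj}

theorem ae_abs_reward_le_one (hM : M.BoundedRewards) (hξ : ∀ k, Measurable (ξ k))
    (hlaw : ∀ k, P.map (ξ k) = M.controllerLaw π) (l : Fin M.H) :
    ∀ᵐ ω ∂P, ∀ k, |(ξ k ω l).2.1| ≤ 1 := by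
  have heval : Measurable fun τ : M.Traj => τ l := measurable_pi_apply l
  have hset : MeasurableSet {x : Step S A | |x.2.1| ≤ 1} :=
    measurableSet_le measurable_snd.fst.abs measurable_const
  have : IsProbabilityMeasure ((M.controllerLaw π).map fun τ => (τ l).1) :=
    Measure.isProbabilityMeasure_map heval.fst.aemeasurable
  have hstep : ∀ᵐ x ∂(M.controllerLaw π).map (fun τ => τ l), |x.2.1| ≤ 1 := by
    rw [MDP.map_controllerLaw_step, Measure.ae_compProd_iff hset]
    exact ae_of_all _ fun x => hM l l.2 x.1 x.2
  refine ae_all_iff.2 fun k =>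
    ae_of_ae_map (p := fun τ : M.Traj => |(τ l).2.1| ≤ 1) (hξ k).aemeasurable ?_
  rw [hlaw k]
  exact ae_of_ae_map heval.aemeasurable hstep

variable [Finite A] [Nonempty A] [MeasurableSingletonClass A] [IsProbabilityMeasure P]

theorem exists_event_excessLoss_block_le (hb : ∀ h a, Measurable fun s => b h s a)
    (hb0 : ∀ h s a, 0 ≤ b h s a) (hξ : ∀ k, Measurable (ξ k)) (hind : iIndepFun ξ P)
    (hlaw : ∀ k, P.map (ξ k) = M.controllerLaw π) (k n : ℕ) [NeZero n] (l : Fin M.H) {t : ℝ}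
    (ht : 0 < t) :
    ∃ T : Set Ω, MeasurableSet T ∧ P Tᶜ ≤ ENNReal.ofReal t ∧ ∀ ω ∈ T,
      ∀ w ∈ unitBall d, ∀ u ∈ unitBall d, ∀ v ∈ unitBall d,
        n * (∫ x, excessLoss (fun x : Step S A => F.φ l x.1.1 x.1.2) (parametricLabel M.H F b l)
            (w, u, v) x ∂(M.controllerLaw π).map (fun τ => τ l) -
          M.expect (M.controllerLaw π) l (fun s a => inner ℝ (F.φ l s a) (u - v) ^ 2) / 2) ≤
        ∑ i : Fin n, excessLoss (fun x : Step S A => F.φ l x.1.1 x.1.2)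
          (parametricLabel M.H F b l) (w, u, v) (ξ (k + i) ω l) +
        96 * (2 + 3 * d * Real.log n + Real.log t⁻¹) := by
  have heval : Measurable fun τ : M.Traj => τ l := measurable_pi_apply l
  have : IsProbabilityMeasure ((M.controllerLaw π).map fun τ => τ l) :=
    Measure.isProbabilityMeasure_map heval.aemeasurable
  have hsample (k : ℕ) : P.map (fun ω => ξ k ω l) = (M.controllerLaw π).map fun τ => τ l := by
    rw [← hlaw k, Measure.map_map heval (hξ k)]
    rfl
  obtain ⟨T, hTm, hTP, hT⟩ := exists_event_excessLoss_le
    (φ := fun x : Step S A => F.φ l x.1.1 x.1.2) ((F.measurable_uncurry l).comp measurable_fst)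
    (fun x => F.norm_φ_le l x.1.1 x.1.2) (measurable_parametricLabel M.H F hb l)
    (fun w hw => abs_parametricLabel_le_two M.H F hb0 l (mem_closedBall_zero_iff.2 hw))
    (abs_parametricLabel_sub_le M.H F b l) (ξ := fun (i : Fin n) ω => ξ (k + i) ω l)
    (fun i => heval.comp (hξ (k + i))) (iIndepFun_comp_add hind heval k n)
    (fun i => hsample (k + i)) ht
  refine ⟨T, hTm, hTP, fun ω hω w hw u hu v hv => ?_⟩
  have hdim : (d + 2 * d : ℝ) = 3 * d := by ring
  rw [MDP.expect_eq_integral_map_step (M.controllerLaw π) l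
      (f := fun s a => inner ℝ (F.φ l s a) (u - v) ^ 2)
      (((F.measurable_uncurry l).inner measurable_const).pow_const 2)]
  simpa only [Fintype.card_fin, finrank_euclideanSpace_fin, hdim] using hT ω hω w u v
    (mem_closedBall_zero_iff.1 hw) (mem_closedBall_zero_iff.1 hu) (mem_closedBall_zero_iff.1 hv)

theorem exists_event_isFitted_isCloseToBestFits (hM : M.BoundedRewards)
    (hb : ∀ h a, Measurable fun s => b h s a) (hb0 : ∀ h s a, 0 ≤ b h s a) (hlam : 0 ≤ lam)
    (hξ : ∀ k, Measurable (ξ k)) (hind : iIndepFun ξ P)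
    (hlaw : ∀ k, P.map (ξ k) = M.controllerLaw π) (e : ℕ) (l : Fin M.H) {t : ℝ} (ht : 0 < t) :
    ∃ T : Set Ω, MeasurableSet T ∧ P Tᶜ ≤ ENNReal.ofReal t ∧ ∀ ω ∈ T, ∀ Q ∈ M.QAll,
      (∀ l', IsFitted M F b lam (fun k => ξ k ω) e l' Q) →
        IsCloseToBestFits M F b π l (fitError d lam (2 ^ e) t) Q := by
  obtain ⟨T, hTm, hTP, hT⟩ := exists_event_excessLoss_block_le (F := F) hb hb0 hξ hind hlaw
    (blockStart M.H e l) (2 ^ e) l ht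
  obtain ⟨R, hRP, hRm, hR⟩ := (ae_abs_reward_le_one hM hξ hlaw l).exists_measurable_mem
  refine ⟨T ∩ R, hTm.inter hRm, ?_, fun ω hω Q hQ hfit => ?_⟩
  · rw [Set.compl_inter]
    exact (measure_union_le _ _).trans (by rwa [mem_ae_iff.1 hRP, add_zero])
  obtain ⟨w', hw', hmaxQ⟩ := exists_maxQ_eq_maxQ_parametricTarget hQ hfit l
  obtain ⟨w, hw, hQw, hridge⟩ := hfit l
  refine ⟨w, hw, hQw, fun θ hθ => ?_⟩
  have hdeviation := hT ω hω.1 w' hw' w hw θ hθ.1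
  have hbest := hθ.expect_sq_le_integral_excessLoss hM hb hb0
    (M.boundedMeasurable_of_mem_QAll hQ (l + 1)) hw' hmaxQ hw
  have hempirical := sum_excessLoss_le_of_isMinOn_ridgeLoss (x := fun k => ξ k ω) hlam (hR ω hω.2)
    hmaxQ hridge hθ.1
  rw [mul_sub] at hdeviation
  push_cast at hdeviation
  have hscaled := mul_le_mul_of_nonneg_left hbest (by positivity : (0 : ℝ) ≤ 2 ^ e)
  rw [fitError, le_div_iff₀ (by positivity)]
  linarith

end FittedTargets

section FailureProbability

theorem exists_event_forall_of_tsum_le {ι Ω : Type*} [Countable ι] [MeasurableSpace Ω]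
    {P : Measure Ω} [IsProbabilityMeasure P] {p : ι → Ω → Prop} {t : ι → ℝ≥0∞} {δ : ℝ}
    (hδ : 0 ≤ δ) (ht : ∑' i, t i ≤ ENNReal.ofReal δ)
    (h : ∀ i, ∃ T : Set Ω, MeasurableSet T ∧ P Tᶜ ≤ t i ∧ ∀ ω ∈ T, p i ω) :
    ∃ T : Set Ω, MeasurableSet T ∧ ENNReal.ofReal (1 - δ) ≤ P T ∧ ∀ ω ∈ T, ∀ i, p i ω := by
  choose T hTm hTP hT using h
  have hm : MeasurableSet (⋂ i, T i) := .iInter hTm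
  refine ⟨⋂ i, T i, hm, ?_, fun ω hω i => hT i ω (Set.mem_iInter.1 hω i)⟩
  have hcompl : P (⋂ i, T i)ᶜ ≤ ENNReal.ofReal δ := by
    rw [Set.compl_iInter]
    exact (measure_iUnion_le _).trans ((ENNReal.tsum_le_tsum hTP).trans ht)
  rw [ENNReal.ofReal_sub _ hδ, ENNReal.ofReal_one, tsub_le_iff_right,
    ← prob_add_prob_compl (μ := P) hm]
  gcongr

theorem tsum_ofReal_div_sq_le {H : ℕ} (hH : 0 < H) {δ : ℝ} (hδ : 0 ≤ δ) :
    ∑' i : ℕ × Fin H, ENNReal.ofReal (δ / (2 * H * ((i.1 + 1 : ℕ) : ℝ) ^ 2)) ≤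
      ENNReal.ofReal δ := by
  have hzeta : HasSum (fun e : ℕ => δ / 2 * (1 / ((e + 1 : ℕ) : ℝ) ^ 2))
      (δ / 2 * (Real.pi ^ 2 / 6)) :=
    .mul_left _ (by simpa using (hasSum_nat_add_iff' 1).2 hasSum_zeta_two)
  have hstages (e : ℕ) : ∑' _l : Fin H, ENNReal.ofReal (δ / (2 * H * ((e + 1 : ℕ) : ℝ) ^ 2)) =
      ENNReal.ofReal (δ / 2 * (1 / ((e + 1 : ℕ) : ℝ) ^ 2)) := by
    have : (0 : ℝ) < H := Nat.cast_pos.2 hH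
    rw [tsum_fintype, Finset.sum_const, Finset.card_univ, Fintype.card_fin, nsmul_eq_mul,
      ← ENNReal.ofReal_natCast, ← ENNReal.ofReal_mul (Nat.cast_nonneg H)]
    congr 1
    field_simp
  have hpi : Real.pi ^ 2 / 6 ≤ 2 := by nlinarith [Real.pi_lt_d2, Real.pi_pos]
  rw [ENNReal.tsum_prod
    (f := fun e (_ : Fin H) => ENNReal.ofReal (δ / (2 * H * ((e + 1 : ℕ) : ℝ) ^ 2)))]
  simp only [hstages]
  rw [← ENNReal.ofReal_tsum_of_nonneg (fun e => by positivity) hzeta.summable, hzeta.tsum_eq]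
  exact ENNReal.ofReal_le_ofReal (by nlinarith)

variable {S A Ω : Type*} [MeasurableSpace S] [MeasurableSpace A] [MeasurableSpace Ω] [Finite A]
  [Nonempty A] [MeasurableSingletonClass A] {P : Measure Ω} [IsProbabilityMeasure P] {M : MDP S A}
  {d : ℕ} {F : Features S A d} {b : QFun S A} {lam : ℝ} {π : Controller S A}
  {ξ : ℕ → Ω → M.Traj}

theorem exists_event_forall_isCloseToBestFits (hM : M.BoundedRewards)
    (hb : ∀ h a, Measurable fun s => b h s a) (hb0 : ∀ h s a, 0 ≤ b h s a) (hlam : 0 ≤ lam)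
    (hξ : ∀ k, Measurable (ξ k)) (hind : iIndepFun ξ P)
    (hlaw : ∀ k, P.map (ξ k) = M.controllerLaw π) {δ : ℝ} (hδ : 0 < δ) :
    ∃ T : Set Ω, MeasurableSet T ∧ ENNReal.ofReal (1 - δ) ≤ P T ∧ ∀ ω ∈ T, ∀ e ≥ 1, ∀ Q ∈ M.QAll,
      (∀ l, IsFitted M F b lam (fun k => ξ k ω) e l Q) →
        ∀ l, IsCloseToBestFits M F b π l (fitError d lam (2 ^ e) (δ / (2 * M.H * e ^ 2))) Q := by
  have : (0 : ℝ) < M.H := Nat.cast_pos.2 M.H_pos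
  obtain ⟨T, hTm, hTP, hT⟩ := exists_event_forall_of_tsum_le hδ.le
    (tsum_ofReal_div_sq_le M.H_pos hδ.le) fun i : ℕ × Fin M.H =>
      exists_event_isFitted_isCloseToBestFits (F := F) hM hb hb0 hlam hξ hind hlaw (i.1 + 1) i.2
        (t := δ / (2 * M.H * ((i.1 + 1 : ℕ) : ℝ) ^ 2)) (by positivity)
  refine ⟨T, hTm, hTP, fun ω hω e he Q hQ hfit l => ?_⟩
  obtain ⟨e, rfl⟩ := Nat.exists_eq_add_of_le' he
  exact hT ω hω (e, l) Q hQ hfit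

end FailureProbability

section FitErrorBound

theorem log_add_one_add_log_inv_le {d H : ℕ} (hd : 0 < d) (hH : 0 < H) {n t : ℝ} (hn : 0 < n)
    (ht : 0 < t) :
    Real.log n + 1 + Real.log t⁻¹ ≤ Real.log (d * n * Real.exp 1 * H / (t / d)) := by
  have hd1 : (1 : ℝ) ≤ d := Nat.one_le_cast.2 hd
  have hH1 : (1 : ℝ) ≤ H := Nat.one_le_cast.2 hH
  have hsplit : d * n * Real.exp 1 * H / (t / d) = d ^ 2 * H * (n * Real.exp 1 * t⁻¹) := by
    field_simp
  rw [hsplit, ← Real.log_exp 1, ← Real.log_mul hn.ne' (Real.exp_pos 1).ne', Real.log_exp,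
    ← Real.log_mul (by positivity) (inv_ne_zero ht.ne')]
  exact Real.log_le_log (by positivity)
    (le_mul_of_one_le_left (by positivity) (one_le_mul_of_one_le_of_one_le (one_le_pow₀ hd1) hH1))

theorem one_le_log_div {d H : ℕ} (hd : 0 < d) (hH : 0 < H) {n t : ℝ} (ht : 0 < t)
    (htn : t ≤ n) : 1 ≤ Real.log (d * n * Real.exp 1 * H / (t / d)) := by
  have hn : 0 < n := ht.trans_le htn
  have hratio : 0 ≤ Real.log n + Real.log t⁻¹ := by
    rw [← Real.log_mul hn.ne' (inv_ne_zero ht.ne'), ← div_eq_mul_inv]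
    exact Real.log_nonneg ((one_le_div ht).2 htn)
  linarith [log_add_one_add_log_inv_le hd hH hn ht]

theorem mul_fitError_le {d H : ℕ} (hd : 0 < d) (hH : 0 < H) {lam n m t : ℝ} (ht : 0 < t)
    (ht2 : t ≤ 1 / 2) (hn : 1 / 2 ≤ n) (hm : 0 < m) (hmn : m ≤ 4 * n) :
    m * fitError d lam m t ≤
      2 * lam + 1152 * (d * Real.log (d * n * Real.exp 1 * H / (t / d))) := by
  have hlog2 : Real.log 2 ≤ 1 / 2 + 1 / 4 := by linarith [Real.log_two_lt_d9]
  have hlogn : -Real.log 2 ≤ Real.log n := by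
    rw [← Real.log_inv]
    exact Real.log_le_log (by norm_num) (by linarith)
  have hlogt : Real.log 2 ≤ Real.log t⁻¹ :=
    Real.log_le_log two_pos ((le_inv_comm₀ two_pos ht).2 (by linarith))
  have hlogm : Real.log m ≤ 2 * Real.log 2 + Real.log n := by
    calc Real.log m ≤ Real.log (2 ^ 2 * n) := Real.log_le_log hm (by linarith)
      _ = 2 * Real.log 2 + Real.log n := by
        rw [Real.log_mul (by norm_num) (by linarith), Real.log_pow, Nat.cast_two]
  have hL := log_add_one_add_log_inv_le hd hH (by linarith : 0 < n) ht
  set L := Real.log (d * n * Real.exp 1 * H / (t / d))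
  have hdL : L ≤ d * L := le_mul_of_one_le_left (by linarith) (Nat.one_le_cast.2 hd)
  have hdm : (d : ℝ) * Real.log m ≤ d * L := by gcongr; linarith
  rw [fitError, mul_div_cancel₀ _ hm.ne']
  linarith

end FitErrorBound

section Uncertainty

theorem sqrt_le_mul_sqrt_add_sqrt {q B lam : ℝ} (hB : 0 ≤ B) (hlam : 0 ≤ lam)
    (hq : q ≤ 6 * lam + 1152 * B) : √q ≤ 34 * (√B + √lam) := by
  refine Real.sqrt_le_iff.2 ⟨by positivity, hq.trans ?_⟩
  have : 0 ≤ √B * √lam := by positivity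
  linarith [add_sq √B √lam, Real.sq_sqrt hB, Real.sq_sqrt hlam]

variable {S A : Type*} [MeasurableSpace S] [MeasurableSpace A] [Countable A]
  [MeasurableSingletonClass A] {M : MDP S A} {d : ℕ} {F : Features S A d} {π : Controller S A}
  {lam : ℝ}

theorem quad_expectedCov_sub_le (hlam : 0 ≤ lam) {n m r : ℝ} (hnm : n ≤ m) {h : Fin M.H}
    {w θ : EuclideanSpace ℝ (Fin d)} (hw : w ∈ unitBall d) (hθ : θ ∈ unitBall d)
    (hclose : m * M.expect (M.controllerLaw π) h
      (fun s a => inner ℝ (F.φ h s a) (w - θ) ^ 2) ≤ r) :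
    quad (expectedCov M F π lam n h) (w - θ) ≤ r + 4 * lam := by
  have hexpect : 0 ≤ M.expect (M.controllerLaw π) h fun s a => inner ℝ (F.φ h s a) (w - θ) ^ 2 :=
    integral_nonneg fun _ => sq_nonneg _
  have hnorm : ‖w - θ‖ ≤ 2 := (norm_sub_le _ _).trans (by
    linarith [mem_closedBall_zero_iff.1 hw, mem_closedBall_zero_iff.1 hθ])
  have hsq : ‖w - θ‖ ^ 2 ≤ 4 := by nlinarith [norm_nonneg (w - θ)]
  rw [quad_expectedCov, mul_comm 4]
  exact add_le_add ((mul_le_mul_of_nonneg_right hnm hexpect).trans hclose)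
    (mul_le_mul_of_nonneg_left hsq hlam)

theorem abs_lin_sub_le_uncertainty (hlam : 0 < lam) (hd : 0 < d) {δ : ℝ} (hδ : 0 < δ)
    (hδ1 : δ < 1) {K e : ℕ} (he : 1 ≤ e) (hK : 2 * M.H ≤ K) (hKe : (K : ℝ) / (4 * M.H) ≤ 2 ^ e)
    (heK : (2 : ℝ) ^ e ≤ 4 * (K / (4 * M.H))) {h : Fin M.H} {w θ : EuclideanSpace ℝ (Fin d)}
    (hw : w ∈ unitBall d) (hθ : θ ∈ unitBall d)
    (hclose : M.expect (M.controllerLaw π) h (fun s a => inner ℝ (F.φ h s a) (w - θ) ^ 2) ≤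
      fitError d lam (2 ^ e) (δ / (2 * M.H * e ^ 2))) (s : S) (a : A) :
    |F.lin w h s a - F.lin θ h s a| ≤ uncertainty M F π 34 lam δ K e h s a := by
  have hH : (1 : ℝ) ≤ M.H := Nat.one_le_cast.2 M.H_pos
  have hn : 1 / 2 ≤ (K : ℝ) / (4 * M.H) := by
    have : (2 * M.H : ℝ) ≤ K := mod_cast hK
    rw [le_div_iff₀ (by positivity)]
    linarith
  have hHe : (1 : ℝ) ≤ M.H * e ^ 2 :=
    one_le_mul_of_one_le_of_one_le hH (one_le_pow₀ (Nat.one_le_cast.2 he))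
  have ht : 0 < δ / (2 * M.H * e ^ 2) := div_pos hδ (by linarith)
  have ht2 : δ / (2 * M.H * e ^ 2) ≤ 1 / 2 := by
    rw [div_le_iff₀ (by linarith)]
    linarith
  have hlog := one_le_log_div hd M.H_pos ht (ht2.trans hn)
  have hquad := quad_expectedCov_sub_le (F := F) (π := π) hlam.le hKe hw hθ
    ((mul_le_mul_of_nonneg_left hclose (by positivity)).trans
      (mul_fitError_le hd M.H_pos ht ht2 hn (by positivity) heK))
  have hsqrt := sqrt_le_mul_sqrt_add_sqrt
    (mul_nonneg (Nat.cast_nonneg d) (zero_le_one.trans hlog)) hlam.le (hquad.trans_eq (by ring))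
  rw [div_div] at hsqrt
  rw [Features.lin, Features.lin, ← inner_sub_right]
  have hcov := posDef_expectedCov (F := F) π hlam (one_half_pos.le.trans hn) h
  refine (abs_inner_le_sqrt_quad_mul hcov _ _).trans ?_
  rw [mul_comm, uncertainty, uncertaintyParam]
  gcongr

end Uncertainty

section Guarantee

variable {S A : Type*} [MeasurableSpace S]

theorem Features.boundedMeasurable_lin {d : ℕ} (F : Features S A d)
    {w : EuclideanSpace ℝ (Fin d)} (hw : w ∈ unitBall d) (h : ℕ) :
    BoundedMeasurable (F.lin w h) 1 where
  measurable a := (F.measurable_φ h a).inner measurable_const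
  abs_le := F.abs_lin_le_one hw h

variable [MeasurableSpace A] {M : MDP S A} {d : ℕ} {F : Features S A d} {Q b : QFun S A}

theorem bellmanError_add_comparatorError (h : ℕ) (θ : EuclideanSpace ℝ (Fin d)) (s : S) (a : A) :
    bellmanError M Q h s a + comparatorError M F Q h θ s a = Q h s a - F.lin θ h s a :=
  sub_add_sub_cancel _ _ _

theorem bellmanError_add_comparatorError_mem_Icc {h : ℕ} {w θ : EuclideanSpace ℝ (Fin d)}
    (hQ : Q h = fun s a => min 1 (F.lin w h s a + b h s a)) (hθ : θ ∈ unitBall d) {s : S} {a : A}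
    {u : ℝ} (hu : |F.lin w h s a - F.lin θ h s a| ≤ u) :
    bellmanError M Q h s a + comparatorError M F Q h θ s a ∈
      Set.Icc (min 0 (-u + b h s a)) (u + b h s a) := by
  obtain ⟨hlow, hup⟩ := abs_le.1 hu
  rw [bellmanError_add_comparatorError, hQ, ← min_sub_sub_right]
  exact ⟨min_le_min (sub_nonneg.2 (abs_le.1 (F.abs_lin_le_one hθ h s a)).2) (by linarith),
    (min_le_right _ _).trans (by linarith)⟩

theorem coe_integral_le_coe_lintegral {X : Type*} [MeasurableSpace X] {μ : Measure X} {f g : X → ℝ}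
    (hf : Integrable f μ) (hfg : f ≤ᵐ[μ] g) :
    ((∫ x, f x ∂μ : ℝ) : EReal) ≤ ((∫⁻ x, ENNReal.ofReal (g x) ∂μ : ℝ≥0∞) : EReal) := by
  have hpos : ∫ x, f x ∂μ ≤ (∫⁻ x, ENNReal.ofReal (f x) ∂μ).toReal := by
    rw [integral_eq_lintegral_pos_part_sub_lintegral_neg_part hf]
    exact sub_le_self _ ENNReal.toReal_nonneg
  calc ((∫ x, f x ∂μ : ℝ) : EReal)
      ≤ (((∫⁻ x, ENNReal.ofReal (f x) ∂μ).toReal : ℝ) : EReal) := EReal.coe_le_coe hpos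
    _ = ((∫⁻ x, ENNReal.ofReal (f x) ∂μ : ℝ≥0∞) : EReal) :=
        EReal.coe_ennreal_toReal hf.lintegral_lt_top.ne
    _ ≤ _ := EReal.coe_ennreal_le_coe_ennreal_iff.2
        (lintegral_mono_ae (hfg.mono fun _ => ENNReal.ofReal_le_ofReal))

variable [MeasurableSingletonClass A]

theorem BoundedMeasurable.integrable_step [Countable A] {f : S → A → ℝ} {c : ℝ}
    (hf : BoundedMeasurable f c) (μ : Measure M.Traj) [IsFiniteMeasure μ] (h : Fin M.H) :
    Integrable (fun τ => f (τ h).1.1 (τ h).1.2) μ :=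
  integrable_of_forall_abs_le (hf.measurable_uncurry.comp (measurable_pi_apply h).fst)
    fun _ => hf.abs_le _ _

variable [Finite A] [Nonempty A]

theorem integral_sum_bellmanError (hM : M.BoundedRewards) {c : ℝ}
    (hQ : ∀ h, BoundedMeasurable (Q h) c) {θ : Fin M.H → EuclideanSpace ℝ (Fin d)}
    (hθ : ∀ h, θ h ∈ unitBall d) (μ : Measure M.Traj) [IsFiniteMeasure μ] :
    ∫ τ, ∑ h : Fin M.H, bellmanError M Q h (τ h).1.1 (τ h).1.2 ∂μ =
      ∫ τ, ∑ h : Fin M.H, (bellmanError M Q h (τ h).1.1 (τ h).1.2 +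
        comparatorError M F Q h (θ h) (τ h).1.1 (τ h).1.2) ∂μ +
      ∑ h : Fin M.H, M.expect μ h fun s a => F.lin (θ h) h s a - M.bellman Q h s a := by
  have herr (h : Fin M.H) := (hM.boundedMeasurable_bellmanError hQ h.2).integrable_step μ h
  have hcomp (h : Fin M.H) := ((hM.boundedMeasurable_bellman h.2 (hQ (h + 1))).sub
    (F.boundedMeasurable_lin (hθ h) h)).integrable_step μ h
  have hfit (h : Fin M.H) := ((F.boundedMeasurable_lin (hθ h) h).sub
    (hM.boundedMeasurable_bellman h.2 (hQ (h + 1)))).integrable_step μ h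
  simp only [MDP.expect, comparatorError]
  rw [integral_finsetSum _ fun h _ => herr h,
    integral_finsetSum _ fun h _ => (herr h).fun_add (hcomp h), ← Finset.sum_add_distrib]
  refine Finset.sum_congr rfl fun h _ => ?_
  rw [← integral_add ((herr h).fun_add (hcomp h)) (hfit h)]
  exact integral_congr_ae (ae_of_all _ fun τ => by ring)

theorem coe_integral_maxQ_sub_value_le (hM : M.BoundedRewards) (hQ : Q ∈ M.QAll)
    {C : Set (Controller S A)} {ε : ℝ} (hmis : LowRankMisspecified M F C ε) {π : Controller S A}
    (hπ : π ∈ C) {G : Fin M.H → S → A → ℝ}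
    (hG : ∀ (h : Fin M.H) (θ : EuclideanSpace ℝ (Fin d)), IsBestPredictor M F π Q h θ → ∀ s a,
      bellmanError M Q h s a + comparatorError M F Q h θ s a ≤ G h s a)
    {π' : Policy S A} (hπ' : IsGreedy M.H Q π') :
    ((∫ s, (maxQ Q 0 s - M.value π' 0 s) ∂M.ρ : ℝ) : EReal) ≤
      ((∫⁻ τ, ENNReal.ofReal (∑ h : Fin M.H, G h (τ h).1.1 (τ h).1.2) ∂M.law π' : ℝ≥0∞) : EReal) +
        (ε : EReal) := by
  obtain ⟨θ, hθ, hε⟩ := hmis π hπ π' Q hQ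
  have hQb := M.boundedMeasurable_of_mem_QAll hQ
  have hint (h : Fin M.H) : Integrable (fun τ : M.Traj => bellmanError M Q h (τ h).1.1 (τ h).1.2 +
      comparatorError M F Q h (θ h) (τ h).1.1 (τ h).1.2) (M.law π') := by
    simp only [bellmanError_add_comparatorError]
    exact ((hQb h).sub (F.boundedMeasurable_lin (hθ h).1 h)).integrable_step _ h
  rw [hM.integral_maxQ_sub_value hQb hQ.2.2 hπ',
    integral_sum_bellmanError hM hQb (fun h => (hθ h).1), EReal.coe_add]
  exact add_le_add
    (coe_integral_le_coe_lintegral (integrable_finsetSum _ fun h _ => hint h)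
      (ae_of_all _ fun τ => Finset.sum_le_sum fun h _ => hG h (θ h) (hθ h) _ _))
    (EReal.coe_le_coe ((le_abs_self _).trans hε))

end Guarantee

end S3Q

end

theorem theorem3 :
    ∃ c : ℝ, 0 < c ∧
      ∀ (S : Type*) (A : Type*) (Ω : Type*)
        [MeasurableSpace S] [MeasurableSpace A] [MeasurableSpace Ω]
        [Fintype A] [Nonempty A] [MeasurableSingletonClass A]
        (P : Measure Ω) [IsProbabilityMeasure P]
        (M : S3Q.MDP S A) (d : ℕ) (F : S3Q.Features S A d)
        (C : Set (S3Q.Controller S A)) (π : S3Q.Controller S A)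
        (b : S3Q.QFun S A) (ε lam δ : ℝ) (ξ : ℕ → Ω → M.Traj),
        0 < d →
        M.BoundedRewards →
        S3Q.LowRankMisspecified M F C ε →
        π ∈ C →
        (∀ h a, Measurable fun s => b h s a) →
        (∀ h s a, 0 ≤ b h s a) →
        0 < lam →
        0 < δ →
        δ < 1 →
        (∀ k, Measurable (ξ k)) →
        iIndepFun ξ P →
        (∀ k, P.map (ξ k) = M.controllerLaw π) →
        ∃ E : Set Ω, MeasurableSet E ∧ ENNReal.ofReal (1 - δ) ≤ P E ∧
          ∀ ω ∈ E, ∀ K : ℕ, 2 * M.H ≤ K →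
            let x : ℕ → M.Traj := fun k => ξ k ω
            let Q : S3Q.QFun S A := S3Q.output M F b lam x K
            let U : Fin M.H → S → A → ℝ :=
              S3Q.uncertainty M F π c lam δ K (S3Q.epochsCompleted M F b lam x K)
            (∀ (h : Fin M.H) (θ : EuclideanSpace ℝ (Fin d)),
              S3Q.IsBestPredictor M F π Q h θ → ∀ (s : S) (a : A),
                min 0 (-U h s a + b h s a) ≤
                    S3Q.bellmanError M Q h s a + S3Q.comparatorError M F Q h θ s a ∧
                  S3Q.bellmanError M Q h s a + S3Q.comparatorError M F Q h θ s a ≤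
                    U h s a + b h s a) ∧
            (∀ π' : S3Q.Policy S A, S3Q.IsGreedy M.H Q π' →
              ∫ s, (S3Q.maxQ Q 0 s - M.optValue 0 s) ∂M.ρ ≤
                  ∫ s, (S3Q.maxQ Q 0 s - M.value π' 0 s) ∂M.ρ ∧
                ((∫ s, (S3Q.maxQ Q 0 s - M.value π' 0 s) ∂M.ρ : ℝ) : EReal) ≤
                  ((∫⁻ τ, ENNReal.ofReal (∑ h : Fin M.H,
                      (U h (τ h).1.1 (τ h).1.2 + b h (τ h).1.1 (τ h).1.2)) ∂M.law π' : ℝ≥0∞) :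
                    EReal) + (ε : EReal)) := by
  refine ⟨34, by norm_num, ?_⟩
  intro S A Ω _ _ _ _ _ _ P _ M d F C π b ε lam δ ξ hd hM hmis hπ hb hb0 hlam hδ hδ1 hξ hind hlaw
  obtain ⟨T, hTm, hTP, hT⟩ :=
    S3Q.exists_event_forall_isCloseToBestFits (F := F) hM hb hb0 hlam.le hξ hind hlaw hδ
  refine ⟨T, hTm, hTP, fun ω hω K hK => ?_⟩
  intro x Q U
  obtain ⟨he, hKe, heK, hQ, hfit⟩ := S3Q.output_spec (M := M) (F := F) (x := x) hlam hb hb0 hK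
  have herr (h : Fin M.H) (θ : EuclideanSpace ℝ (Fin d)) (hθ : S3Q.IsBestPredictor M F π Q h θ)
      (s : S) (a : A) : S3Q.bellmanError M Q h s a + S3Q.comparatorError M F Q h θ s a ∈
        Set.Icc (min 0 (-U h s a + b h s a)) (U h s a + b h s a) := by
    obtain ⟨w, hw, hQw, hclose⟩ := hT ω hω _ he Q hQ hfit h
    exact S3Q.bellmanError_add_comparatorError_mem_Icc hQw hθ.1
      (S3Q.abs_lin_sub_le_uncertainty hlam hd hδ hδ1 he hK hKe heK hw hθ.1 (hclose θ hθ) s a)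
  have hV := (M.boundedMeasurable_of_mem_QAll hQ 0).integrable_maxQ (μ := M.ρ) measurable_id
  exact ⟨herr, fun π' hπ' => ⟨hM.integral_sub_optValue_le hV π',
    S3Q.coe_integral_maxQ_sub_value_le hM hQ hmis hπ
      (fun h θ hθ s a => (herr h θ hθ s a).2) hπ'⟩⟩
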